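/- **Theorem 8.1.** All graphs are finite, undirected, uncolored and simple, with at least one vertex. Let $X$ be a graph with vertex set $\{1,\dots,n\}$ and incidency (adjacency) matrix $d\in M_n(\mathbb C)$. Let $H(X)$ be the universal unital $C^*$-algebra generated by the entries of an $n\times n$ matrix $v=(v_{ij})$, subject to the relations that $v$ is magic biunitary (all $v_{ij}$ are self-adjoint projections, and on each row and each column of $v$ they are pairwise orthogonal and sum up to $1$) and that $dv=vd$. Let $v:\mathbb C(X)\to\mathbb C(X)\otimes H(X)$, $v(\delta_i)=\sum_j\delta_j\otimes v_{ji}$, be the universal coaction. The graph $X$ is called *quantum homogeneous* if every $f\in\mathbb C(X)$ with $v(f)=f\otimes 1$ is constant, and *homogeneous* if its automorphism group acts transitively on the vertices. A graph with $n\le 8$ vertices is quantum homogeneous if and only if it is homogeneous. Up to isomorphism there are exactly $38$ such graphs, namely the following ones, which are pairwise non-isomorphic: (a) the point, $2$ points, the segment, $3$ points, the triangle; (b) the graphs with $n=4,5,6,7,8$ vertices with no edges, or with all possible edges; (c) the disjoint unions of $2$, $3$ or $4$ segments, of $2$ triangles, and of $2$ tetrahedra (complete graphs on $4$ vertices), and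 the complements of these five graphs; (d) the disjoint union of $2$ squares, and its complement; (e) the pentagon, the heptagon, and the complement of the heptagon; (f) the hexagon, the octagon, the $8$-spoke wheel (the graph on $\mathbb Z/8$ in which $i,j$ are adjacent when $i-j\in\{1,4,7\}$), and the complements of these three graphs; (g) the cube (the graph with the $8$ vertices and the $12$ edges of a cube), and its complement. -/

import Mathlib

universe u

/-- A matrix `v` over a `*`-algebra is a *magic biunitary* if its entries are self-adjoint
projections and each of its rows and each of its columns is a partition of unity, meaning that its
entries are pairwise orthogonal and sum up to `1`. -/
structure IsMagicBiunitary {X A : Type*} [Fintype X] [Ring A] [StarRing A] (v : Matrix X X A) :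
    Prop where
  isStarProjection : ∀ i j, IsStarProjection (v i j)
  row_orthogonal : ∀ i j k, j ≠ k → v i j * v i k = 0
  col_orthogonal : ∀ i j k, i ≠ k → v i j * v k j = 0
  row_sum : ∀ i, ∑ j, v i j = 1
  col_sum : ∀ j, ∑ i, v i j = 1

/-- The matrix `v` with entries in the complex algebra `A` commutes with the scalar matrix `d`. -/
def CommutesWith {X A : Type*} [Fintype X] [Ring A] [Algebra ℂ A] (d : Matrix X X ℂ)
    (v : Matrix X X A) : Prop :=
  d.map (algebraMap ℂ A) * v = v * d.map (algebraMap ℂ A)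

/-! ### The universal C*-algebra `H(X,d)` -/

/-- The free unital complex `*`-algebra on self-adjoint generators `e i j`, for `i j : X`: the
algebra of the free monoid of words in the letters `X × X`. The matrix `d` is only recorded in the
type, as the seminorm put on this algebra below depends on it. -/
def FreeStarAlg {X : Type u} (_d : Matrix X X ℂ) : Type u :=
  MonoidAlgebra ℂ (FreeMonoid (X × X))

namespace FreeStarAlg

variable {X : Type u} (d : Matrix X X ℂ)

noncomputable instance : Ring (FreeStarAlg d) :=
  inferInstanceAs (Ring (MonoidAlgebra ℂ (FreeMonoid (X × X))))

noncomputable instance : Algebra ℂ (FreeStarAlg d) :=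
  inferInstanceAs (Algebra ℂ (MonoidAlgebra ℂ (FreeMonoid (X × X))))

/-- The word `w`, as an element of the free `*`-algebra. -/
noncomputable def word (w : FreeMonoid (X × X)) : FreeStarAlg d :=
  MonoidAlgebra.of ℂ (FreeMonoid (X × X)) w

/-- The generators of the free `*`-algebra. -/
noncomputable def gen (i j : X) : FreeStarAlg d := word d (FreeMonoid.of (i, j))

theorem word_one : word d 1 = 1 := map_one (MonoidAlgebra.of ℂ (FreeMonoid (X × X)))

theorem word_mul (w z : FreeMonoid (X × X)) : word d (w * z) = word d w * word d z :=
  map_mul (MonoidAlgebra.of ℂ (FreeMonoid (X × X))) w z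

variable {d} in
theorem induction_on {motive : FreeStarAlg d → Prop} (p : FreeStarAlg d)
    (word : ∀ w, motive (FreeStarAlg.word d w)) (add : ∀ p q, motive p → motive q → motive (p + q))
    (smul : ∀ (c : ℂ) p, motive p → motive (c • p)) : motive p :=
  MonoidAlgebra.induction_on (R := ℂ) (M := FreeMonoid (X × X)) p word add smul

/-- The involution, as a ring morphism to the opposite ring: it conjugates the coefficients and
fixes the generators. -/
noncomputable def starHom : FreeStarAlg d →+* (FreeStarAlg d)ᵐᵒᵖ :=
  MonoidAlgebra.liftNCRingHom
    ((algebraMap ℂ (FreeStarAlg d)ᵐᵒᵖ).comp (starRingEnd ℂ))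
    (FreeMonoid.lift fun x : X × X => MulOpposite.op (gen d x.1 x.2))
    (fun c _ => Algebra.commutes (starRingEnd ℂ c) _)

theorem starHom_smul (c : ℂ) (p : FreeStarAlg d) :
    starHom d (c • p) = starRingEnd ℂ c • starHom d p := by
  have h : starHom d (algebraMap ℂ (FreeStarAlg d) c)
      = algebraMap ℂ (FreeStarAlg d)ᵐᵒᵖ (starRingEnd ℂ c) := by
    have := MonoidAlgebra.liftNCRingHom_single
      ((algebraMap ℂ (FreeStarAlg d)ᵐᵒᵖ).comp (starRingEnd ℂ))
      (FreeMonoid.lift fun x : X × X => MulOpposite.op (gen d x.1 x.2))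
      (fun c _ => Algebra.commutes (starRingEnd ℂ c) _) 1 c
    refine Eq.trans this ?_
    simp
  rw [Algebra.smul_def, map_mul, h, ← Algebra.smul_def]

theorem starHom_gen (i j : X) : starHom d (gen d i j) = MulOpposite.op (gen d i j) := by
  have := MonoidAlgebra.liftNCRingHom_single
    ((algebraMap ℂ (FreeStarAlg d)ᵐᵒᵖ).comp (starRingEnd ℂ))
    (FreeMonoid.lift fun x : X × X => MulOpposite.op (gen d x.1 x.2))
    (fun c _ => Algebra.commutes (starRingEnd ℂ c) _) (FreeMonoid.of (i, j)) 1
  refine Eq.trans this ?_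
  simp

theorem starHom_starHom (p : FreeStarAlg d) :
    (starHom d (starHom d p).unop).unop = p := by
  induction p using induction_on with
  | word w =>
    induction w using FreeMonoid.recOn with
    | one => simp [word_one]
    | of_mul x w ih =>
      have h := starHom_gen d x.1 x.2
      rw [word_mul, map_mul, MulOpposite.unop_mul, map_mul, MulOpposite.unop_mul, ih]
      change (starHom d (starHom d (gen d x.1 x.2)).unop).unop * _ = gen d x.1 x.2 * _
      rw [h, MulOpposite.unop_op, h, MulOpposite.unop_op]
  | add p q hp hq => simp [hp, hq]
  | smul c p hp => simp [starHom_smul, hp]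

noncomputable instance : StarRing (FreeStarAlg d) where
  star p := (starHom d p).unop
  star_involutive := starHom_starHom d
  star_mul p q := by simp
  star_add p q := by simp

theorem star_def (p : FreeStarAlg d) : star p = (starHom d p).unop := rfl

instance : StarModule ℂ (FreeStarAlg d) where
  star_smul c p := by simp [star_def, starHom_smul]

theorem star_gen (i j : X) : star (gen d i j) = gen d i j := by
  simp [star_def, starHom_gen]

/-- The morphism out of the free algebra that maps the generators to the entries of `u`. -/
noncomputable def lift {B : Type*} [Ring B] [Algebra ℂ B] (u : Matrix X X B) :
    FreeStarAlg d →ₐ[ℂ] B :=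
  MonoidAlgebra.lift ℂ B (FreeMonoid (X × X)) (FreeMonoid.lift fun x => u x.1 x.2)

theorem lift_gen {B : Type*} [Ring B] [Algebra ℂ B] (u : Matrix X X B) (i j : X) :
    lift d u (gen d i j) = u i j := by
  refine (MonoidAlgebra.lift_of _ _).trans ?_
  simp

theorem lift_star {B : Type*} [Ring B] [StarRing B] [Algebra ℂ B] [StarModule ℂ B]
    (u : Matrix X X B) (hu : ∀ i j, star (u i j) = u i j) (p : FreeStarAlg d) :
    lift d u (star p) = star (lift d u p) := by
  induction p using induction_on with
  | word w =>
    induction w using FreeMonoid.recOn with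
    | one => simp [word_one]
    | of_mul x w ih =>
      have h : word d (FreeMonoid.of x) = gen d x.1 x.2 := rfl
      simp [word_mul, ih, h, star_gen, lift_gen, hu]
  | add p q hp hq => simp [hp, hq]
  | smul c p hp => simp [hp]

variable [Fintype X]

/-- The elements that have to vanish for the matrix of generators to be a magic biunitary that
commutes with `d`. (The generators are already self-adjoint.) -/
inductive IsRelator : FreeStarAlg d → Prop
  | idempotent (i j : X) : IsRelator (gen d i j * gen d i j - gen d i j)
  | row_orthogonal (i j k : X) (h : j ≠ k) : IsRelator (gen d i j * gen d i k)
  | col_orthogonal (i j k : X) (h : i ≠ k) : IsRelator (gen d i j * gen d k j)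
  | row_sum (i : X) : IsRelator (∑ j, gen d i j - 1)
  | col_sum (j : X) : IsRelator (∑ i, gen d i j - 1)
  | commute (i j : X) :
      IsRelator (∑ k, d i k • gen d k j - ∑ k, d k j • gen d i k)

/-- A C*-seminorm on the free `*`-algebra that vanishes on the relators: a seminorm that is
submultiplicative and satisfies the C*-identity. -/
structure IsCStarSeminorm (q : Seminorm ℂ (FreeStarAlg d)) : Prop where
  mul_le : ∀ a b, q (a * b) ≤ q a * q b
  star_mul_self : ∀ a, q (star a * a) = q a ^ 2
  relator : ∀ a, IsRelator d a → q a = 0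

variable {d}

theorem IsCStarSeminorm.star_le {q : Seminorm ℂ (FreeStarAlg d)} (hq : IsCStarSeminorm d q)
    (a : FreeStarAlg d) : q (star a) ≤ q a := by
  have h1 := hq.star_mul_self (star a)
  have h2 := hq.mul_le (star (star a)) (star a)
  rw [star_star] at h1 h2
  rw [h1] at h2
  by_contra! h
  have h3 : 0 ≤ q a := apply_nonneg q a
  nlinarith

theorem IsCStarSeminorm.word_le {q : Seminorm ℂ (FreeStarAlg d)} (hq : IsCStarSeminorm d q)
    (w : FreeMonoid (X × X)) : q (word d w) ≤ 1 := by
  have key : ∀ t : ℝ, t = t ^ 2 → t ≤ 1 := fun t ht => by nlinarith [sq_nonneg (t - 1)]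
  induction w using FreeMonoid.recOn with
  | one =>
    refine key _ ?_
    have := hq.star_mul_self (1 : FreeStarAlg d)
    rwa [star_one, one_mul, ← word_one] at this
  | of_mul x w ih =>
    have hx : q (gen d x.1 x.2) ≤ 1 := by
      refine key _ ?_
      have h1 := hq.star_mul_self (gen d x.1 x.2)
      have h2 := hq.relator _ (IsRelator.idempotent x.1 x.2)
      rw [star_gen] at h1
      rw [← h1]
      have h3 := map_add_le_add q (gen d x.1 x.2 * gen d x.1 x.2 - gen d x.1 x.2) (gen d x.1 x.2)
      have h4 := map_sub_le_add q (gen d x.1 x.2 * gen d x.1 x.2)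
        (gen d x.1 x.2 * gen d x.1 x.2 - gen d x.1 x.2)
      rw [sub_add_cancel] at h3
      rw [sub_sub_cancel] at h4
      linarith
    rw [word_mul]
    refine (hq.mul_le _ _).trans ?_
    exact mul_le_one₀ hx (apply_nonneg q _) ih

variable (d)

/-- The index set of the supremum that defines the norm. -/
abbrev CSeminorms := {q : Seminorm ℂ (FreeStarAlg d) // IsCStarSeminorm d q}

instance : Nonempty (CSeminorms d) :=
  ⟨⟨0, ⟨fun _ _ => by simp, fun _ => by simp, fun _ _ => by simp⟩⟩⟩

theorem bddAbove (p : FreeStarAlg d) :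
    BddAbove (Set.range fun q : CSeminorms d => q.1 p) := by
  suffices h : ∃ C : ℝ, ∀ q : CSeminorms d, q.1 p ≤ C by
    obtain ⟨C, hC⟩ := h
    exact ⟨C, by rintro _ ⟨q, rfl⟩; exact hC q⟩
  induction p using induction_on with
  | word w => exact ⟨1, fun q => q.2.word_le w⟩
  | add p r hp hr =>
    obtain ⟨C, hC⟩ := hp
    obtain ⟨D, hD⟩ := hr
    exact ⟨C + D, fun q => (map_add_le_add q.1 p r).trans (add_le_add (hC q) (hD q))⟩
  | smul c p hp =>
    obtain ⟨C, hC⟩ := hp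
    refine ⟨‖c‖ * C, fun q => ?_⟩
    rw [map_smul_eq_mul]
    exact mul_le_mul_of_nonneg_left (hC q) (norm_nonneg c)

/-- The largest C*-seminorm that vanishes on the relators. -/
noncomputable instance : Norm (FreeStarAlg d) where
  norm p := ⨆ q : CSeminorms d, q.1 p

theorem norm_def (p : FreeStarAlg d) : ‖p‖ = ⨆ q : CSeminorms d, q.1 p := rfl

variable {d}

theorem le_norm {q : Seminorm ℂ (FreeStarAlg d)} (hq : IsCStarSeminorm d q)
    (p : FreeStarAlg d) : q p ≤ ‖p‖ :=
  le_ciSup (bddAbove d p) (⟨q, hq⟩ : CSeminorms d)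

theorem norm_le {p : FreeStarAlg d} {C : ℝ}
    (h : ∀ q : Seminorm ℂ (FreeStarAlg d), IsCStarSeminorm d q → q p ≤ C) : ‖p‖ ≤ C :=
  ciSup_le fun q => h q.1 q.2

theorem norm_nonneg' (p : FreeStarAlg d) : 0 ≤ ‖p‖ :=
  Real.iSup_nonneg fun q => apply_nonneg q.1 p

variable (d)

noncomputable instance : SeminormedRing (FreeStarAlg d) :=
  RingSeminorm.toSeminormedRing
    { toFun := fun p => ‖p‖
      map_zero' := le_antisymm (norm_le fun q _ => (map_zero q).le) (norm_nonneg' _)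
      add_le' := fun p r => norm_le fun q hq =>
        (map_add_le_add q p r).trans (add_le_add (le_norm hq p) (le_norm hq r))
      neg' := fun p => by simp only [norm_def, map_neg_eq_map]
      mul_le' := fun p r => norm_le fun q hq => (hq.mul_le p r).trans
        (mul_le_mul (le_norm hq p) (le_norm hq r) (apply_nonneg q r) (norm_nonneg' p)) }

noncomputable instance : NormedAlgebra ℂ (FreeStarAlg d) where
  norm_smul_le c p := norm_le fun q hq => by
    rw [map_smul_eq_mul]
    exact mul_le_mul_of_nonneg_left (le_norm hq p) (norm_nonneg c)

instance : NormedStarGroup (FreeStarAlg d) where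
  norm_star_le p := norm_le fun _ hq => (hq.star_le p).trans (le_norm hq p)

theorem norm_sq_le (p : FreeStarAlg d) : ‖p‖ * ‖p‖ ≤ ‖star p * p‖ := by
  have h : ‖p‖ ≤ √‖star p * p‖ := norm_le fun q hq =>
    Real.le_sqrt_of_sq_le ((hq.star_mul_self p).symm.le.trans (le_norm hq _))
  have h2 := mul_le_mul h h (norm_nonneg' p) (Real.sqrt_nonneg _)
  rwa [Real.mul_self_sqrt (norm_nonneg' _)] at h2

theorem norm_relator {p : FreeStarAlg d} (h : IsRelator d p) : ‖p‖ = 0 :=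
  le_antisymm (norm_le fun _ hq => (hq.relator p h).le) (norm_nonneg' p)

end FreeStarAlg

/-- The universal C*-algebra `H(X,d)` generated by the entries of a magic biunitary matrix indexed
by `X` that commutes with `d`: the (separated) completion of the free `*`-algebra on the entries for
the largest C*-seminorm that vanishes on the relations. -/
def UnivAlg {X : Type u} [Fintype X] (d : Matrix X X ℂ) : Type u :=
  UniformSpace.Completion (FreeStarAlg d)

namespace UnivAlg

open UniformSpace

variable {X : Type u} [Fintype X] (d : Matrix X X ℂ)

noncomputable instance : NormedRing (UnivAlg d) :=
  inferInstanceAs (NormedRing (Completion (FreeStarAlg d)))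

noncomputable instance : Algebra ℂ (UnivAlg d) :=
  inferInstanceAs (Algebra ℂ (Completion (FreeStarAlg d)))

noncomputable instance : NormedAlgebra ℂ (UnivAlg d) where
  norm_smul_le := norm_smul_le (α := ℂ) (β := Completion (FreeStarAlg d))

instance : CompleteSpace (UnivAlg d) :=
  inferInstanceAs (CompleteSpace (Completion (FreeStarAlg d)))

/-- The canonical morphism from the free `*`-algebra. -/
noncomputable def of : FreeStarAlg d →+* UnivAlg d := Completion.coeRingHom

theorem continuous_of : Continuous (of d) := Completion.continuous_coe _

theorem denseRange_of : DenseRange (of d) := Completion.denseRange_coe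

theorem norm_of (p : FreeStarAlg d) : ‖of d p‖ = ‖p‖ := Completion.norm_coe p

theorem of_smul (c : ℂ) (p : FreeStarAlg d) : of d (c • p) = c • of d p :=
  Completion.coe_smul c p

variable {d} in
theorem induction_on {motive : UnivAlg d → Prop} (a : UnivAlg d)
    (closed : IsClosed {a | motive a}) (of : ∀ p, motive (of d p)) : motive a :=
  Completion.induction_on (α := FreeStarAlg d) a closed of

/-- The involution of `H(X,d)` extends the one of the free `*`-algebra by continuity. -/
noncomputable instance : Star (UnivAlg d) where
  star := Completion.map (star : FreeStarAlg d → FreeStarAlg d)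

theorem continuous_star' : Continuous (star : UnivAlg d → UnivAlg d) := Completion.continuous_map

theorem star_of (p : FreeStarAlg d) : star (of d p) = of d (star p) :=
  Completion.map_coe (starNormedAddGroupHom (E := FreeStarAlg d)).uniformContinuous p

noncomputable instance : StarRing (UnivAlg d) where
  star_involutive a := by
    induction a using induction_on with
    | closed => exact isClosed_eq ((continuous_star' d).comp (continuous_star' d)) continuous_id
    | of p => simp [star_of]
  star_mul a b := by
    induction a using induction_on with
    | closed =>
      exact isClosed_eq ((continuous_star' d).comp (continuous_id.mul continuous_const))
        (continuous_const.mul (continuous_star' d))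
    | of p =>
      induction b using induction_on with
      | closed =>
        exact isClosed_eq ((continuous_star' d).comp (continuous_const.mul continuous_id))
          ((continuous_star' d).mul continuous_const)
      | of r => simp only [← map_mul, star_of, star_mul]
  star_add a b := by
    induction a using induction_on with
    | closed =>
      exact isClosed_eq ((continuous_star' d).comp (continuous_id.add continuous_const))
        ((continuous_star' d).add continuous_const)
    | of p =>
      induction b using induction_on with
      | closed =>
        exact isClosed_eq ((continuous_star' d).comp (continuous_const.add continuous_id))
          (continuous_const.add (continuous_star' d))
      | of r => simp only [← map_add, star_of, star_add]

instance : StarModule ℂ (UnivAlg d) where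
  star_smul c a := by
    induction a using induction_on with
    | closed =>
      exact isClosed_eq ((continuous_star' d).comp (continuous_const_smul c))
        ((continuous_star' d).const_smul (star c))
    | of p => simp only [← of_smul, star_of, star_smul]

instance : CStarRing (UnivAlg d) where
  norm_mul_self_le a := by
    induction a using induction_on with
    | closed =>
      exact isClosed_le (continuous_norm.mul continuous_norm)
        (continuous_norm.comp ((continuous_star' d).mul continuous_id))
    | of p =>
      rw [star_of, ← map_mul, norm_of, norm_of]
      exact FreeStarAlg.norm_sq_le d p

noncomputable instance : CStarAlgebra (UnivAlg d) where

/-- The universal magic biunitary: the matrix of the generators `v i j` of `H(X,d)`. -/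
noncomputable def v : Matrix X X (UnivAlg d) := fun i j => of d (FreeStarAlg.gen d i j)

theorem of_relator {p : FreeStarAlg d} (h : FreeStarAlg.IsRelator d p) : of d p = 0 :=
  norm_eq_zero.mp ((norm_of d p).trans (FreeStarAlg.norm_relator d h))

theorem isMagicBiunitary_v : IsMagicBiunitary (v d) where
  isStarProjection i j :=
    ⟨sub_eq_zero.mp (by simpa [v] using of_relator d (.idempotent i j)),
      (star_of d _).trans (congrArg (of d) (FreeStarAlg.star_gen d i j))⟩
  row_orthogonal i j k h := by simpa [v] using of_relator d (.row_orthogonal i j k h)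
  col_orthogonal i j k h := by simpa [v] using of_relator d (.col_orthogonal i j k h)
  row_sum i := sub_eq_zero.mp (by simpa [v] using of_relator d (.row_sum i))
  col_sum j := sub_eq_zero.mp (by simpa [v] using of_relator d (.col_sum j))

theorem commutesWith_v : CommutesWith d (v d) := by
  ext i j
  have h := of_relator d (.commute i j)
  simp only [map_sub, map_sum, of_smul, sub_eq_zero] at h
  simp only [Matrix.mul_apply, Matrix.map_apply, ← Algebra.smul_def, ← Algebra.commutes]
  exact h

/-- The universal property of `H(X,d)`. -/
theorem existsUnique_starAlgHom {B : Type*} [CStarAlgebra B] (u : Matrix X X B)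
    (hu : IsMagicBiunitary u) (hd : CommutesWith d u) :
    ∃! φ : UnivAlg d →⋆ₐ[ℂ] B, ∀ i j, φ (v d i j) = u i j := by
  let L : FreeStarAlg d →ₐ[ℂ] B := FreeStarAlg.lift d u
  have Lgen : ∀ i j, L (FreeStarAlg.gen d i j) = u i j := FreeStarAlg.lift_gen d u
  have Lstar : ∀ p, L (star p) = star (L p) :=
    FreeStarAlg.lift_star d u fun i j => (hu.isStarProjection i j).isSelfAdjoint
  let q : Seminorm ℂ (FreeStarAlg d) := (normSeminorm ℂ B).comp L.toLinearMap
  have hq : FreeStarAlg.IsCStarSeminorm d q := by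
    refine ⟨fun a b => ?_, fun a => ?_, fun a ha => ?_⟩
    · change ‖L (a * b)‖ ≤ ‖L a‖ * ‖L b‖
      rw [map_mul]
      exact norm_mul_le _ _
    · change ‖L (star a * a)‖ = ‖L a‖ ^ 2
      rw [map_mul, Lstar, CStarRing.norm_star_mul_self, sq]
    · change ‖L a‖ = 0
      rw [norm_eq_zero]
      cases ha with
      | idempotent i j =>
        rw [map_sub, map_mul, Lgen, sub_eq_zero]
        exact (hu.isStarProjection i j).isIdempotentElem
      | row_orthogonal i j k h => simp [Lgen, hu.row_orthogonal i j k h]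
      | col_orthogonal i j k h => simp [Lgen, hu.col_orthogonal i j k h]
      | row_sum i => simp [Lgen, hu.row_sum i]
      | col_sum j => simp [Lgen, hu.col_sum j]
      | commute i j =>
        have h := congrFun (congrFun hd i) j
        simp only [Matrix.mul_apply, Matrix.map_apply, ← Algebra.smul_def,
          ← Algebra.commutes] at h
        simp [Lgen, h]
  have Lle : ∀ p, ‖L p‖ ≤ ‖p‖ := FreeStarAlg.le_norm hq
  have Lcont : Continuous L.toRingHom :=
    (LinearMap.mkContinuous L.toLinearMap 1 fun p => (Lle p).trans (one_mul ‖p‖).ge).continuous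
  let Φ : UnivAlg d →+* B := Completion.extensionHom L.toRingHom Lcont
  have Φcont : Continuous Φ := Completion.continuous_extension
  have Φof : ∀ p, Φ (of d p) = L p := Completion.extensionHom_coe L.toRingHom Lcont
  refine ⟨{ Φ with
    commutes' := fun c => ?_
    map_star' := fun a => ?_ }, fun i j => (Φof _).trans (Lgen i j), fun ψ hψ => ?_⟩
  · change Φ (algebraMap ℂ (UnivAlg d) c) = _
    rw [Algebra.algebraMap_eq_smul_one, ← map_one (of d), ← of_smul, Φof, map_smul, map_one,
      Algebra.algebraMap_eq_smul_one]
  · change Φ (star a) = star (Φ a)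
    induction a using induction_on with
    | closed =>
      exact isClosed_eq (Φcont.comp (continuous_star' d)) (continuous_star.comp Φcont)
    | of p => rw [star_of, Φof, Φof, Lstar]
  · have ψcont : Continuous ψ :=
      AddMonoidHomClass.continuous_of_bound ψ 1 fun a =>
        (NonUnitalStarAlgHom.norm_apply_le ψ a).trans (one_mul ‖a‖).ge
    ext a
    change ψ a = Φ a
    induction a using induction_on with
    | closed => exact isClosed_eq ψcont Φcont
    | of p =>
      rw [Φof]
      induction p using FreeStarAlg.induction_on with
      | word w =>
        induction w using FreeMonoid.recOn with
        | one => simp [FreeStarAlg.word_one]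
        | of_mul x w ih =>
          rw [FreeStarAlg.word_mul, map_mul, map_mul, map_mul, ih]
          exact congrArg (· * _) ((hψ x.1 x.2).trans (Lgen x.1 x.2).symm)
      | add p r hp hr => simp [hp, hr]
      | smul c p hp => simp [of_smul, hp]

end UnivAlg

/-! ### Quantum homogeneous and homogeneous graphs -/

open scoped TensorProduct

open Classical in
/-- The universal coaction `v : ℂ(X) → ℂ(X) ⊗ H(X,d)`, given on the Dirac masses by
`v(δ_i) = ∑ j, δ_j ⊗ v_{ji}`. -/
noncomputable def coaction {X : Type u} [Fintype X] (d : Matrix X X ℂ) :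
    (X → ℂ) →ₗ[ℂ] (X → ℂ) ⊗[ℂ] UnivAlg d :=
  (Pi.basisFun ℂ X).constr ℂ fun i => ∑ j, Pi.single j 1 ⊗ₜ[ℂ] UnivAlg.v d j i

/-- The pair `(X,d)` is quantum homogeneous if the only functions fixed by the universal coaction
are the constant ones. -/
def QuantumHomogeneous {X : Type u} [Fintype X] (d : Matrix X X ℂ) : Prop :=
  ∀ f : X → ℂ, coaction d f = f ⊗ₜ[ℂ] 1 → ∃ c : ℂ, ∀ i, f i = c

namespace SimpleGraph

open Classical in
/-- A finite graph is quantum homogeneous if its vertex set, together with its incidency matrix, is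
quantum homogeneous. -/
def IsQuantumHomogeneous {V : Type u} [Fintype V] (G : SimpleGraph V) : Prop :=
  QuantumHomogeneous (G.adjMatrix ℂ)

/-- A graph is homogeneous if its symmetry group acts transitively on the vertices. -/
def IsHomogeneous {V : Type u} (G : SimpleGraph V) : Prop :=
  ∀ i j : V, ∃ σ : G ≃g G, σ i = j

/-- The disjoint union of `m` copies of the graph `G`. -/
def copies (m : ℕ) {V : Type u} (G : SimpleGraph V) : SimpleGraph (Fin m × V) where
  Adj x y := x.1 = y.1 ∧ G.Adj x.2 y.2
  symm := ⟨fun _ _ h => ⟨h.1.symm, h.2.symm⟩⟩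
  loopless := ⟨fun _ h => h.2.ne rfl⟩

/-- The 8-spoke wheel: an octagon together with its 4 longest diagonals. -/
def wheel8 : SimpleGraph (ZMod 8) := circulantGraph {1, 4, 7}

/-- The graph of the cube: two vertices are adjacent if they differ in exactly one of their three
coordinates. -/
def cube : SimpleGraph (Fin 3 → Bool) where
  Adj x y := ∃! i, x i ≠ y i
  symm := ⟨fun _ _ h => by simpa only [ne_comm] using h⟩
  loopless := ⟨fun _ ⟨_, h, _⟩ => h rfl⟩

/-- The homogeneous graphs with at most 8 vertices. -/
def table : List (Σ V : Type, SimpleGraph V) :=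
  -- point, 2 points, segment, 3 points, triangle
  [⟨Fin 1, ⊥⟩, ⟨Fin 2, ⊥⟩, ⟨Fin 2, ⊤⟩, ⟨Fin 3, ⊥⟩, ⟨Fin 3, ⊤⟩,
  -- graphs with 4, 5, 6, 7, 8 vertices with no edges, or with all possible edges
    ⟨Fin 4, ⊥⟩, ⟨Fin 5, ⊥⟩, ⟨Fin 6, ⊥⟩, ⟨Fin 7, ⊥⟩, ⟨Fin 8, ⊥⟩,
    ⟨Fin 4, ⊤⟩, ⟨Fin 5, ⊤⟩, ⟨Fin 6, ⊤⟩, ⟨Fin 7, ⊤⟩, ⟨Fin 8, ⊤⟩,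
  -- 2, 3 or 4 segments, 2 triangles, 2 tetrahedra, and their complements
    ⟨_, copies 2 (⊤ : SimpleGraph (Fin 2))⟩, ⟨_, (copies 2 (⊤ : SimpleGraph (Fin 2)))ᶜ⟩,
    ⟨_, copies 3 (⊤ : SimpleGraph (Fin 2))⟩, ⟨_, (copies 3 (⊤ : SimpleGraph (Fin 2)))ᶜ⟩,
    ⟨_, copies 4 (⊤ : SimpleGraph (Fin 2))⟩, ⟨_, (copies 4 (⊤ : SimpleGraph (Fin 2)))ᶜ⟩,
    ⟨_, copies 2 (⊤ : SimpleGraph (Fin 3))⟩, ⟨_, (copies 2 (⊤ : SimpleGraph (Fin 3)))ᶜ⟩,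
    ⟨_, copies 2 (⊤ : SimpleGraph (Fin 4))⟩, ⟨_, (copies 2 (⊤ : SimpleGraph (Fin 4)))ᶜ⟩,
  -- 2 squares and its complement
    ⟨_, copies 2 (cycleGraph 4)⟩, ⟨_, (copies 2 (cycleGraph 4))ᶜ⟩,
  -- pentagon, heptagon and its complement
    ⟨_, cycleGraph 5⟩, ⟨_, cycleGraph 7⟩, ⟨_, (cycleGraph 7)ᶜ⟩,
  -- hexagon, octagon, 8-spoke wheel, and their complements
    ⟨_, cycleGraph 6⟩, ⟨_, (cycleGraph 6)ᶜ⟩, ⟨_, cycleGraph 8⟩, ⟨_, (cycleGraph 8)ᶜ⟩,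
    ⟨_, wheel8⟩, ⟨_, wheel8ᶜ⟩,
  -- cube and its complement
    ⟨_, cube⟩, ⟨_, cubeᶜ⟩]

/-- Isomorphism of graphs with vertex set `{0, …, n - 1}`, for some `n`. -/
instance isoSetoid : Setoid (Σ n : ℕ, SimpleGraph (Fin n)) where
  r A B := Nonempty (A.2 ≃g B.2)
  iseqv := ⟨fun _ => ⟨Iso.refl⟩, fun ⟨e⟩ => ⟨e.symm⟩, fun ⟨e⟩ ⟨f⟩ => ⟨f.comp e⟩⟩

end SimpleGraph

/-!
Write `d` for the adjacency matrix of a graph and `v` for the universal magic biunitary.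

A homogeneous graph is quantum homogeneous because every automorphism, seen as a permutation
matrix, is a magic biunitary over `ℂ` that commutes with `d`; the character that it defines
shows that a function fixed by the coaction is invariant under the automorphism
(`apply_eq_of_coaction_eq`).

Conversely, if a scalar matrix `m` commutes with `v`, then its row sums and its diagonal are fixed
by the coaction, so that they are constant when the graph is quantum homogeneous
(`QuantumHomogeneous.exists_row_sum_eq`, `QuantumHomogeneous.exists_diag_eq`). With `m = d` and
`m = d ^ 3`, such a graph is regular and all its vertices lie on the same number of triangles. As
`v` also commutes with the all-ones matrix, the same holds for the complement, and one of the two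
graphs has a degree `k` with `2 * k + 1 ≤ n`.

For `n ≤ 8` these conditions leave only few graphs, up to isomorphism. This is verified by a search
over the symmetric adjacency matrices whose rows, written as bit masks, have `k` ones
(`RowSearch.searchRows_eq_true`). Numbering a vertex, one of its neighbours, its other neighbours
and the remaining neighbours of the second vertex in this order keeps the search small. Whenever
the number of triangles is the same at all vertices, the search finds a copy of one of `20` models
inside the graph, and an injective morphism between regular graphs of the same degree and the same
order is an isomorphism (`SimpleGraph.nonempty_iso_of_injective`). The models and their complements
are in the table, the graphs in the table are homogeneous, being built from graphs with evident
symmetries, and they are told apart by counting vertices, triangles and pairs of vertices with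
common neighbours, in the graph or in its complement.
-/

/-! ### Functions fixed by the universal coaction -/

section Coaction

variable {X : Type u} [Fintype X] (d : Matrix X X ℂ)

open Classical in
theorem coaction_eq_sum (f : X → ℂ) :
    coaction d f = ∑ i, f i • ∑ j, (Pi.single j 1 : X → ℂ) ⊗ₜ[ℂ] UnivAlg.v d j i := by
  rw [coaction, Module.Basis.constr_apply_fintype]
  simp

/-- A function is fixed by the universal coaction as soon as it is, as a column vector, fixed by
the universal magic biunitary. -/
theorem coaction_eq_of_sum_smul_v {f : X → ℂ}
    (h : ∀ j, ∑ i, f i • UnivAlg.v d j i = f j • (1 : UnivAlg d)) :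
    coaction d f = f ⊗ₜ[ℂ] 1 := by
  classical
  rw [coaction_eq_sum]
  simp only [Finset.smul_sum, ← TensorProduct.tmul_smul]
  rw [Finset.sum_comm]
  simp only [← TensorProduct.tmul_sum, h]
  simp only [TensorProduct.tmul_smul, TensorProduct.smul_tmul', ← TensorProduct.sum_tmul]
  congr 1
  ext i
  simp [Finset.sum_apply, Pi.single_apply]

theorem sum_smul_v_of_coaction_eq {f : X → ℂ} (h : coaction d f = f ⊗ₜ[ℂ] 1) (j : X) :
    ∑ i, f i • UnivAlg.v d j i = f j • (1 : UnivAlg d) := by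
  classical
  let φ : (X → ℂ) ⊗[ℂ] UnivAlg d →ₗ[ℂ] UnivAlg d :=
    TensorProduct.lift (LinearMap.lsmul ℂ (UnivAlg d) ∘ₗ LinearMap.proj j)
  have hφ : ∀ (g : X → ℂ) a, φ (g ⊗ₜ a) = g j • a := fun g a => by simp [φ]
  have := congrArg φ h
  rw [coaction_eq_sum] at this
  simpa [map_sum, hφ, Pi.single_apply] using this

variable {d}

theorem UnivAlg.sum_smul_v_eq {m : Matrix X X ℂ} (hm : CommutesWith m (UnivAlg.v d))
    (i j : X) : ∑ k, m i k • UnivAlg.v d k j = ∑ k, m k j • UnivAlg.v d i k := by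
  have h := congrFun (congrFun hm i) j
  simpa only [Matrix.mul_apply, Matrix.map_apply, ← Algebra.smul_def, ← Algebra.commutes] using h

/-- The row sums of a matrix that commutes with `v` are constant: the constant function is fixed
by `v`, hence so is its image under the matrix. -/
theorem QuantumHomogeneous.exists_row_sum_eq (hd : QuantumHomogeneous d) {m : Matrix X X ℂ}
    (hm : CommutesWith m (UnivAlg.v d)) : ∃ c, ∀ i, ∑ j, m i j = c := by
  refine hd (fun i => ∑ j, m i j) (coaction_eq_of_sum_smul_v d fun j => ?_)
  have hv := UnivAlg.isMagicBiunitary_v d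
  simp only [Finset.sum_smul]
  rw [Finset.sum_comm, Finset.sum_congr rfl fun k _ => (UnivAlg.sum_smul_v_eq hm j k).symm,
    Finset.sum_comm]
  simp only [← Finset.smul_sum, hv.row_sum]

/-- The diagonal of a matrix `m` that commutes with `v` is constant: multiplying the `(j, i)`
entry of `m v = v m` by `v j i` leaves `m j j • v j i = m i i • v j i`, by orthogonality in the
rows and columns of `v`. -/
theorem QuantumHomogeneous.exists_diag_eq (hd : QuantumHomogeneous d) {m : Matrix X X ℂ}
    (hm : CommutesWith m (UnivAlg.v d)) : ∃ c, ∀ i, m i i = c := by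
  classical
  refine hd (fun i => m i i) (coaction_eq_of_sum_smul_v d fun j => ?_)
  have hv := UnivAlg.isMagicBiunitary_v d
  have key : ∀ i, m i i • UnivAlg.v d j i = m j j • UnivAlg.v d j i := fun i => by
    have h := congrArg (UnivAlg.v d j i * ·) (UnivAlg.sum_smul_v_eq hm j i)
    simp only [Finset.mul_sum, mul_smul_comm] at h
    rw [Finset.sum_eq_single j (fun k _ hk => by rw [hv.col_orthogonal _ _ _ hk.symm, smul_zero])
      (by simp), Finset.sum_eq_single i
      (fun k _ hk => by rw [hv.row_orthogonal _ _ _ hk.symm, smul_zero]) (by simp),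
      (hv.isStarProjection j i).isIdempotentElem.eq] at h
    exact h.symm
  simp only [key, ← Finset.smul_sum, hv.row_sum]

theorem CommutesWith.mul {A : Type*} [Ring A] [Algebra ℂ A] {v : Matrix X X A}
    {m m' : Matrix X X ℂ} (h : CommutesWith m v) (h' : CommutesWith m' v) :
    CommutesWith (m * m') v := by
  unfold CommutesWith at *
  rw [Matrix.map_mul, Matrix.mul_assoc, h', ← Matrix.mul_assoc, h, Matrix.mul_assoc]

/-- A function on the vertices that is fixed by `v` is invariant under the classical symmetries:
these are the characters of the universal algebra. -/
theorem apply_eq_of_coaction_eq (σ : Equiv.Perm X) (hσ : ∀ i j, d (σ i) (σ j) = d i j)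
    {f : X → ℂ} (h : coaction d f = f ⊗ₜ[ℂ] 1) (i : X) : f (σ i) = f i := by
  classical
  let w : Matrix X X ℂ := fun i j => if i = σ j then 1 else 0
  have hw : IsMagicBiunitary w := by
    refine ⟨fun i j => ?_, fun i j k h => ?_, fun i j k h => ?_, fun i => ?_, fun j => ?_⟩
    · constructor
      · by_cases h : i = σ j <;> simp [IsIdempotentElem, w, h]
      · by_cases h : i = σ j <;> simp [IsSelfAdjoint, w, h]
    · by_cases h1 : i = σ j <;> simp [w, h1, h]
    · by_cases h1 : i = σ j
      · have h2 : k ≠ σ j := fun h2 => h (h1.trans h2.symm)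
        simp [w, h2]
      · simp [w, h1]
    · simp [w, ← Equiv.symm_apply_eq]
    · simp [w]
  have hwd : CommutesWith d w := by
    ext i j
    have h1 : ∀ k, i = σ k ↔ k = σ.symm i := fun k => by
      rw [← Equiv.symm_apply_eq, eq_comm]
    have h2 := hσ (σ.symm i) j
    have h3 : (d * w) i j = (w * d) i j := by
      rw [Matrix.mul_apply, Matrix.mul_apply]
      simp only [w, h1]
      simpa using h2
    simpa using h3
  obtain ⟨φ, hφ, -⟩ := UnivAlg.existsUnique_starAlgHom d w hw hwd
  have h3 := congrArg φ (sum_smul_v_of_coaction_eq d h (σ i))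
  simpa [map_sum, hφ, w] using h3.symm

end Coaction

/-! ### Quantum homogeneous graphs and their symmetries -/

namespace SimpleGraph

theorem IsHomogeneous.isQuantumHomogeneous {V : Type u} [Fintype V] {G : SimpleGraph V}
    (hG : G.IsHomogeneous) : G.IsQuantumHomogeneous := by
  intro f hf
  rcases isEmpty_or_nonempty V with hV | ⟨⟨i⟩⟩
  · exact ⟨0, fun i => hV.elim i⟩
  · refine ⟨f i, fun j => ?_⟩
    obtain ⟨σ, rfl⟩ := hG i j
    exact apply_eq_of_coaction_eq σ.toEquiv (fun a b => by
      have h : G.Adj (σ.toEquiv a) (σ.toEquiv b) ↔ G.Adj a b := σ.map_rel_iff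
      rw [adjMatrix_apply, adjMatrix_apply]
      classical exact if_congr h rfl rfl) hf i

section

variable {V : Type u} [Fintype V] (G : SimpleGraph V)

open Classical in
/-- `G` is regular of degree `k`, and all its vertices lie on the same number of closed walks of
length `3`. Both numbers are written as sums over the vertices. -/
def IsTriangleRegular (k : ℕ) : Prop :=
  (∀ a, ∑ b, (if G.Adj a b then 1 else 0) = k) ∧
    ∃ t : ℕ, ∀ a, ∑ b, ∑ c, (if G.Adj a b ∧ G.Adj b c ∧ G.Adj c a then 1 else 0) = t

variable {G}

open Classical in
/-- The graph `H` will be `G` or its complement. -/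
theorem IsQuantumHomogeneous.isTriangleRegular_of_commutesWith [Nonempty V]
    (hG : G.IsQuantumHomogeneous) {H : SimpleGraph V}
    (hH : CommutesWith (H.adjMatrix ℂ) (UnivAlg.v (G.adjMatrix ℂ))) :
    ∃ k, H.IsTriangleRegular k := by
  obtain ⟨i⟩ := ‹Nonempty V›
  obtain ⟨c, hc⟩ := QuantumHomogeneous.exists_row_sum_eq hG hH
  obtain ⟨t, ht⟩ := QuantumHomogeneous.exists_diag_eq hG (hH.mul (hH.mul hH))
  have ht' : ∀ a, ((∑ b, ∑ c, (if H.Adj a b ∧ H.Adj b c ∧ H.Adj c a then 1 else 0) : ℕ) : ℂ)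
      = t := fun a => by
    rw [← ht a]
    push_cast
    simp only [Matrix.mul_apply, adjMatrix_apply, Finset.mul_sum, ite_and, mul_ite, mul_one,
      mul_zero]
    refine Finset.sum_congr rfl fun b _ => Finset.sum_congr rfl fun c _ => ?_
    by_cases h1 : H.Adj a b <;> by_cases h2 : H.Adj b c <;> simp [h1, h2]
  have hc' : ∀ a, ((∑ b, (if H.Adj a b then 1 else 0) : ℕ) : ℂ) = c := fun a => by
    rw [← hc a]
    simp [adjMatrix_apply]
  refine ⟨∑ b, (if H.Adj i b then 1 else 0), fun a => ?_,
    ∑ b, ∑ c, (if H.Adj i b ∧ H.Adj b c ∧ H.Adj c i then 1 else 0), fun a => ?_⟩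
  · exact Nat.cast_injective (R := ℂ) ((hc' a).trans (hc' i).symm)
  · exact Nat.cast_injective (R := ℂ) ((ht' a).trans (ht' i).symm)

theorem IsQuantumHomogeneous.isTriangleRegular [Nonempty V] (hG : G.IsQuantumHomogeneous) :
    ∃ k, G.IsTriangleRegular k := by
  classical
  convert hG.isTriangleRegular_of_commutesWith (UnivAlg.commutesWith_v _)

theorem IsQuantumHomogeneous.isTriangleRegular_compl [Nonempty V]
    (hG : G.IsQuantumHomogeneous) : ∃ k, Gᶜ.IsTriangleRegular k := by
  classical
  refine hG.isTriangleRegular_of_commutesWith ?_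
  have hv := UnivAlg.isMagicBiunitary_v (G.adjMatrix ℂ)
  have h := UnivAlg.sum_smul_v_eq (UnivAlg.commutesWith_v (G.adjMatrix ℂ))
  have hcompl : ∀ [DecidableRel Gᶜ.Adj] i j, Gᶜ.adjMatrix ℂ i j =
      1 - (if i = j then 1 else 0) - G.adjMatrix ℂ i j := by
    intro _ i j
    by_cases h1 : i = j
    · simp [h1]
    · by_cases h2 : G.Adj i j <;> simp [h1, h2]
  ext i j
  simp only [Matrix.mul_apply, Matrix.map_apply, ← Algebra.smul_def, ← Algebra.commutes]
  simp only [hcompl, sub_smul, Finset.sum_sub_distrib, one_smul, hv.row_sum, hv.col_sum, h i j]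
  simp

end

end SimpleGraph

/-! ### Graphs as lists of bit masks -/

namespace RowSearch

/-- The `j`-th binary digit of `r`. This and the following functions are written in terms of
operations on `ℕ` that the kernel evaluates on binary representations. -/
def bit (r j : ℕ) : Bool := Nat.beq (Nat.land 1 (Nat.shiftRight r j)) 1

theorem bit_eq_testBit (r j : ℕ) : bit r j = r.testBit j := by
  rw [Bool.eq_iff_iff, bit, Nat.beq_eq, Nat.testBit]
  change 1 &&& (r >>> j) = 1 ↔ _
  rw [Nat.one_and_eq_mod_two]
  simp

/-- Given the rows `i - 1, …, 0` of a symmetric adjacency matrix, the number whose binary digits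
below `i` are those of row `i`, above which come the digits of `acc`. -/
def column (i : ℕ) : List ℕ → ℕ → ℕ
  | [], acc => acc
  | r :: rs, acc => column i rs (Nat.add (Nat.land 1 (Nat.shiftRight r i)) (Nat.mul 2 acc))

/-- Whether `check` holds for every list of rows, to be found in reverse order, that extends the
rows `i - 1, …, 0` in `rs` by `m` more rows, where row `i` is one of the masks in `L i` and agrees
with the previous rows, in that the matrix is symmetric with zeros on the diagonal. -/
def searchRows (L : ℕ → List ℕ) (check : List ℕ → Bool) : ℕ → ℕ → List ℕ → Bool
  | 0, _, rs => check rs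
  | m + 1, i, rs => (L i).all fun r =>
      cond (Nat.beq (Nat.mod r (Nat.pow 2 (Nat.succ i))) (column i rs 0))
        (searchRows L check m (Nat.succ i) (r :: rs)) true

/-- The list `row (i - 1), …, row 0`. -/
def rowsBelow (row : ℕ → ℕ) : ℕ → List ℕ
  | 0 => []
  | i + 1 => row i :: rowsBelow row i

/-- The `a`-th row in a list of `n` rows in reverse order. -/
def rowAt (n : ℕ) (rs : List ℕ) (a : ℕ) : ℕ := rs.getD (Nat.sub (Nat.sub n 1) a) 0

theorem rowAt_rowsBelow (row : ℕ → ℕ) {n a : ℕ} (h : a < n) :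
    rowAt n (rowsBelow row n) a = row a := by
  induction n with
  | zero => omega
  | succ n ih =>
    change (row n :: rowsBelow row n).getD (n + 1 - 1 - a) 0 = _
    rcases Nat.lt_succ_iff_lt_or_eq.mp h with h | rfl
    · rw [← ih h, show n + 1 - 1 - a = (n - 1 - a) + 1 by omega, List.getD_cons_succ]
      rfl
    · simp

/-- Prepended to the digits of `acc`, the digits read off the column are those of row `i` below
`m`. -/
theorem column_rowsBelow {row : ℕ → ℕ} {i : ℕ} (acc : ℕ) (m : ℕ)
    (hsymm : ∀ j < m, (row j).testBit i = (row i).testBit j) :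
    column i (rowsBelow row m) acc = 2 ^ m * acc + row i % 2 ^ m := by
  induction m generalizing acc with
  | zero => simp [rowsBelow, column, Nat.mod_one]
  | succ m ih =>
    have h1 : Nat.land 1 (Nat.shiftRight (row m) i) = ((row i).testBit m).toNat := by
      rw [← hsymm m (Nat.lt_succ_self m)]
      change 1 &&& (row m >>> i) = _
      rw [Nat.one_and_eq_mod_two, Nat.toNat_testBit, Nat.shiftRight_eq_div_pow]
    rw [rowsBelow, column, ih _ fun j hj => hsymm j (hj.trans (Nat.lt_succ_self m)), h1,
      Nat.mod_pow_succ, Nat.toNat_testBit]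
    change 2 ^ m * (_ + 2 * acc) + _ = _
    ring

/-- Soundness of the search: if it succeeds, then `check` holds for every symmetric matrix with zero
diagonal whose rows are among the allowed ones. -/
theorem check_of_searchRows {L : ℕ → List ℕ} {check : List ℕ → Bool} {n : ℕ} {row : ℕ → ℕ}
    (hL : ∀ i < n, row i ∈ L i)
    (hsymm : ∀ i < n, ∀ j < i, (row j).testBit i = (row i).testBit j)
    (hdiag : ∀ i < n, (row i).testBit i = false) {m i : ℕ} (hi : m + i = n)
    (h : searchRows L check m i (rowsBelow row i) = true) : check (rowsBelow row n) = true := by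
  induction m generalizing i with
  | zero => rwa [← hi, zero_add]
  | succ m ih =>
    refine ih (i := i + 1) (by omega) ?_
    have hin : i < n := by omega
    have h1 := List.all_eq_true.mp h _ (hL i hin)
    have h2 : Nat.beq (Nat.mod (row i) (Nat.pow 2 (Nat.succ i))) (column i (rowsBelow row i) 0)
        = true := by
      rw [Nat.beq_eq, column_rowsBelow _ _ (hsymm i hin)]
      change row i % 2 ^ (i + 1) = _
      rw [Nat.mod_pow_succ, ← Nat.toNat_testBit, hdiag i hin]
      simp
    rw [h2] at h1
    exact h1

/-! ### Walk counts and embeddings in terms of bit masks -/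

/-- The number of `i < n` that satisfy `p`. -/
def countBelow (p : ℕ → Bool) : ℕ → ℕ
  | 0 => 0
  | n + 1 => cond (p n) (Nat.succ (countBelow p n)) (countBelow p n)

theorem countBelow_eq_sum (p : ℕ → Bool) (n : ℕ) :
    countBelow p n = ∑ i : Fin n, if p i then 1 else 0 := by
  induction n with
  | zero => rfl
  | succ n ih =>
    rw [Fin.sum_univ_castSucc, countBelow, ih]
    simp only [Fin.val_castSucc, Fin.val_last]
    by_cases h : p n = true <;> simp [h]

/-- The sum of `f i` over all `i < n`. -/
def sumBelow (f : ℕ → ℕ) : ℕ → ℕ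
  | 0 => 0
  | n + 1 => Nat.add (sumBelow f n) (f n)

theorem sumBelow_eq_sum (f : ℕ → ℕ) (n : ℕ) : sumBelow f n = ∑ i : Fin n, f i := by
  induction n with
  | zero => rfl
  | succ n ih =>
    rw [Fin.sum_univ_castSucc, sumBelow, ih]
    rfl

/-- The number of closed walks of length `3` at the vertex `a`. -/
def walks3 (n : ℕ) (row : ℕ → ℕ) (a : ℕ) : ℕ :=
  sumBelow (fun b => cond (bit (row a) b) (countBelow (bit (Nat.land (row a) (row b))) n) 0) n

theorem walks3_eq_sum (n : ℕ) (row : ℕ → ℕ) (a : ℕ) :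
    walks3 n row a = ∑ b : Fin n, ∑ c : Fin n,
      if (row a).testBit b ∧ (row b).testBit c ∧ (row a).testBit c then 1 else 0 := by
  rw [walks3, sumBelow_eq_sum]
  refine Finset.sum_congr rfl fun b _ => ?_
  rw [bit_eq_testBit, countBelow_eq_sum]
  cases h : (row a).testBit b
  · simp
  · refine Finset.sum_congr rfl fun c _ => ?_
    rw [bit_eq_testBit]
    change (if (row a &&& row b).testBit c = true then 1 else 0) = _
    rw [Nat.testBit_and]
    simp [and_comm]

/-- A graph with vertices `0, …, n - 1` is coded by the list of the lists of the neighbours `j < i`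
of each vertex `i`. The function tells whether the partial injective graph morphism that maps the
vertices below `p.length` to the entries of `p` extends to the vertices described by the code. -/
def embeds (n : ℕ) (adj : ℕ → ℕ → Bool) : List (List ℕ) → List ℕ → Bool
  | [], _ => true
  | nbrs :: code, p => (List.range n).any fun x =>
      nbrs.all (fun b => (p[b]?).any (adj x)) && p.all (fun y => !Nat.beq x y) &&
        embeds n adj code (p ++ [x])

/-- Soundness of `embeds`: the list `q` contains the values of the extended morphism. -/
theorem exists_list_of_embeds {n : ℕ} {adj : ℕ → ℕ → Bool} {code : List (List ℕ)} {p : List ℕ}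
    (hp : p.Nodup) (hpn : ∀ x ∈ p, x < n) (h : embeds n adj code p = true) :
    ∃ q : List ℕ, p <+: q ∧ q.Nodup ∧ (∀ x ∈ q, x < n) ∧ q.length = p.length + code.length ∧
      ∀ t nbrs, code[t]? = some nbrs → ∀ b ∈ nbrs,
        ∃ x y, q[p.length + t]? = some x ∧ q[b]? = some y ∧ adj x y = true := by
  induction code generalizing p with
  | nil => exact ⟨p, List.prefix_rfl, hp, hpn, rfl, by simp⟩
  | cons nbrs code ih =>
    simp only [embeds, List.any_eq_true, List.mem_range, Bool.and_eq_true, List.all_eq_true,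
      Bool.not_eq_true'] at h
    obtain ⟨x, hx, ⟨h1, h2⟩, h3⟩ := h
    have hxp : x ∉ p := fun hxp => by simpa using h2 x hxp
    obtain ⟨q, hpq, hq, hqn, hlen, hadj⟩ := ih (p := p ++ [x])
      (List.nodup_append.mpr ⟨hp, List.nodup_singleton x, by grind⟩) (by grind) h3
    have hpre : p <+: q := (List.prefix_append p [x]).trans hpq
    have hget : ∀ {r : List ℕ} {b y : ℕ}, r <+: q → r[b]? = some y → q[b]? = some y := by
      rintro r b y ⟨s, rfl⟩ hy
      have := (List.getElem?_eq_some_iff.mp hy).1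
      rwa [List.getElem?_append_left this]
    refine ⟨q, hpre, hq, hqn, by simp at hlen ⊢; omega, fun t nbrs' ht b hb => ?_⟩
    cases t with
    | zero =>
      obtain rfl : nbrs = nbrs' := by simpa using ht
      have h4 := h1 b hb
      rw [Option.any_eq_true] at h4
      obtain ⟨y, hy, hxy⟩ := h4
      exact ⟨x, y, hget hpq (by simp), hget hpre hy, hxy⟩
    | succ t =>
      obtain ⟨x', y, h4, h5, h6⟩ := hadj t nbrs' (by simpa using ht) b hb
      refine ⟨x', y, ?_, h5, h6⟩
      rw [← h4]
      congr 1
      simp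
      omega

/-! ### The search for regular graphs of small degree -/

/-- The codes of the graphs to be found, each preceded by the degree of the graph. -/
def models : List (ℕ × List (List ℕ)) :=
  [(0, [[]]), (0, [[], []]), (0, [[], [], []]), (0, [[], [], [], []]), (0, [[], [], [], [], []]),
    (0, [[], [], [], [], [], []]), (0, [[], [], [], [], [], [], []]),
    (0, [[], [], [], [], [], [], [], []]),
    (1, [[], [0], [], [2]]), (1, [[], [0], [], [2], [], [4]]),
    (1, [[], [0], [], [2], [], [4], [], [6]]),
    (2, [[], [0], [1], [2], [0, 3]]),
    (2, [[], [0], [1], [2], [3], [0, 4]]),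
    (2, [[], [0], [0, 1], [], [3], [3, 4]]),
    (2, [[], [0], [1], [2], [3], [4], [0, 5]]),
    (2, [[], [0], [1], [2], [3], [4], [5], [0, 6]]),
    (2, [[], [0], [1], [0, 2], [], [4], [5], [4, 6]]),
    (3, [[], [0], [0, 1], [0, 1, 2], [], [4], [4, 5], [4, 5, 6]]),
    (3, [[], [0], [1], [2], [0, 3], [1, 4], [2, 5], [0, 3, 6]]),
    (3, [[], [0], [0], [1, 2], [0], [1, 4], [2, 4], [3, 5, 6]])]

/-- The masks below `2 ^ n` with `k` binary digits `1`. -/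
def rowMasks (n k : ℕ) : List ℕ :=
  (List.range (2 ^ n)).filter fun r => Nat.beq (countBelow (bit r) n) k

/-- The rows to be tried for the adjacency matrix of a regular graph of degree `k`, if its vertices
are ordered such that the neighbours of `0` are `1, …, k` and the neighbours of `1` that lie
above `k` are `k + 1, …, k + s` for some `s`. -/
def rowChoices (n k : ℕ) : ℕ → List ℕ
  | 0 => [2 * (2 ^ k - 1)]
  | 1 => (rowMasks n k).filter fun r =>
      (List.range n).any fun s => Nat.beq (r / 2 ^ (k + 1)) (2 ^ s - 1)
  | _ => rowMasks n k

/-- If the graph with the given rows has the same number of closed walks of length `3` at all its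
vertices, then it contains one of the models of degree `k`.
As the models are homogeneous, their vertex `0` may be mapped to the vertex `0`. -/
def checkRows (n k : ℕ) (rs : List ℕ) : Bool :=
  !(List.range n).all (fun a => Nat.beq (walks3 n (rowAt n rs) a) (walks3 n (rowAt n rs) 0)) ||
    models.any fun M => Nat.beq M.1 k && Nat.beq M.2.length n &&
      embeds n (fun a => bit (rowAt n rs a)) M.2.tail [0]

/-- The outcome of the search, for graphs with `m + 1` vertices and degree `k`. For odd `m + 1` and
`k` there is no such graph, hence nothing to be checked at the end of the search. -/
theorem searchRows_eq_true : ∀ m < 8, ∀ k ≤ m / 2,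
    searchRows (rowChoices (m + 1) k) (checkRows (m + 1) k) (m + 1) 0 [] = true := by
  decide +kernel

open Classical in
/-- The rows of the adjacency matrix of a graph, as masks. -/
noncomputable def row {n : ℕ} (G : SimpleGraph (Fin n)) (i : ℕ) : ℕ :=
  Nat.ofBits fun j : Fin n => decide (∃ h : i < n, G.Adj ⟨i, h⟩ j)

variable {n k : ℕ} {G : SimpleGraph (Fin n)}

theorem testBit_row {i j : ℕ} :
    (row G i).testBit j = true ↔ ∃ (hi : i < n) (hj : j < n), G.Adj ⟨i, hi⟩ ⟨j, hj⟩ := by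
  classical
  rw [row, Nat.testBit_ofBits]
  by_cases hj : j < n <;> simp [hj]

theorem testBit_row_fin (i j : Fin n) : (row G i).testBit j = true ↔ G.Adj i j := by
  rw [testBit_row]
  exact ⟨fun ⟨_, _, h⟩ => h, fun h => ⟨i.2, j.2, h⟩⟩

theorem row_mem_rowMasks (hG : G.IsTriangleRegular k) {i : ℕ} (hi : i < n) :
    row G i ∈ rowMasks n k := by
  classical
  rw [rowMasks, List.mem_filter, List.mem_range, Nat.beq_eq, countBelow_eq_sum]
  refine ⟨Nat.ofBits_lt_two_pow _, ?_⟩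
  rw [← hG.1 ⟨i, hi⟩]
  refine Finset.sum_congr rfl fun j _ => ?_
  rw [bit_eq_testBit]
  exact if_congr (testBit_row_fin ⟨i, hi⟩ j) rfl rfl

theorem row_zero (hn : 0 < n) (hk : k < n)
    (h : ∀ j : Fin n, G.Adj ⟨0, hn⟩ j ↔ 1 ≤ (j : ℕ) ∧ (j : ℕ) < k + 1) :
    row G 0 = 2 * (2 ^ k - 1) := by
  refine Nat.eq_of_testBit_eq fun j => ?_
  rw [Bool.eq_iff_iff, testBit_row]
  cases j with
  | zero => simp
  | succ j =>
    rw [Nat.testBit_succ, Nat.mul_div_cancel_left _ two_pos, Nat.testBit_two_pow_sub_one,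
      decide_eq_true_iff]
    simp only [h]
    constructor
    · rintro ⟨_, _, h1⟩
      omega
    · intro h1
      exact ⟨hn, by omega, by simp; omega⟩

theorem row_one_div {s : ℕ} (hn : 1 < n) (hs : k + 1 + s ≤ n)
    (h : ∀ j : Fin n, k + 1 ≤ (j : ℕ) → (G.Adj ⟨1, hn⟩ j ↔ (j : ℕ) < k + 1 + s)) :
    row G 1 / 2 ^ (k + 1) = 2 ^ s - 1 := by
  refine Nat.eq_of_testBit_eq fun j => ?_
  rw [Nat.testBit_div_two_pow, Bool.eq_iff_iff, testBit_row, Nat.testBit_two_pow_sub_one,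
    decide_eq_true_iff]
  constructor
  · rintro ⟨_, hj, h1⟩
    have := (h _ (by simp)).mp h1
    simp at this
    omega
  · intro hj
    exact ⟨hn, by omega, (h _ (by simp)).mpr (by simp; omega)⟩

/-- A graph on at most `8` vertices that is regular of small degree, with the same number of
triangles at each vertex, contains a model of the same degree, if its vertices are well ordered. -/
theorem exists_injective_of_ordered (hn : 0 < n) (hn8 : n ≤ 8) (hk : 2 * k + 1 ≤ n)
    (hG : G.IsTriangleRegular k)
    (h0 : ∀ j : Fin n, G.Adj ⟨0, hn⟩ j ↔ 1 ≤ (j : ℕ) ∧ (j : ℕ) < k + 1)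
    (h1 : ∃ s, k + 1 + s ≤ n ∧ ∀ h : 1 < n, ∀ j : Fin n,
      k + 1 ≤ (j : ℕ) → (G.Adj ⟨1, h⟩ j ↔ (j : ℕ) < k + 1 + s)) :
    ∃ M ∈ models, M.1 = k ∧ M.2.length = n ∧ ∃ f : Fin n → Fin n, f.Injective ∧
      ∀ i j : Fin n, j < i → ∀ nbrs, M.2[(i : ℕ)]? = some nbrs → (j : ℕ) ∈ nbrs →
        G.Adj (f i) (f j) := by
  classical
  have hrow : ∀ i < n, row G i ∈ rowChoices n k i := fun i hi => by
    match i with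
    | 0 => simp [rowChoices, row_zero hn (by omega) h0]
    | 1 =>
      obtain ⟨s, hs, h1⟩ := h1
      rw [rowChoices, List.mem_filter, List.any_eq_true]
      refine ⟨row_mem_rowMasks hG hi, s, List.mem_range.mpr (by omega), ?_⟩
      rw [Nat.beq_eq, row_one_div hi hs (h1 hi)]
    | i + 2 => exact row_mem_rowMasks hG hi
  have hcheck : checkRows n k (rowsBelow (row G) n) = true := by
    refine check_of_searchRows hrow (fun i _ j _ => ?_) (fun i _ => ?_) (add_zero n) ?_
    · rw [Bool.eq_iff_iff, testBit_row, testBit_row]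
      exact ⟨fun ⟨h, h', h''⟩ => ⟨h', h, h''.symm⟩, fun ⟨h, h', h''⟩ => ⟨h', h, h''.symm⟩⟩
    · rw [Bool.eq_false_iff, Ne, testBit_row]
      exact fun ⟨_, _, h⟩ => h.ne rfl
    · obtain ⟨m, rfl⟩ : ∃ m, n = m + 1 := ⟨n - 1, by omega⟩
      exact searchRows_eq_true m (by omega) k (by omega)
  have hwalks : ∀ a : Fin n, walks3 n (rowAt n (rowsBelow (row G) n)) a =
      ∑ b, ∑ c, if G.Adj a b ∧ G.Adj b c ∧ G.Adj c a then 1 else 0 := fun a => by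
    rw [walks3_eq_sum]
    refine Finset.sum_congr rfl fun b _ => Finset.sum_congr rfl fun c _ => ?_
    rw [rowAt_rowsBelow _ a.2, rowAt_rowsBelow _ b.2]
    simp only [testBit_row_fin, G.adj_comm c a]
  obtain ⟨t, ht⟩ := hG.2
  rw [checkRows, Bool.or_eq_true, List.any_eq_true] at hcheck
  rcases hcheck with hcheck | ⟨M, hM, hMe⟩
  · -- By assumption the numbers of closed walks are constant.
    exfalso
    rw [Bool.not_eq_true', List.all_eq_false] at hcheck
    obtain ⟨a, ha, hne⟩ := hcheck
    rw [Nat.beq_eq] at hne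
    exact hne (((hwalks ⟨a, List.mem_range.mp ha⟩).trans (ht _)).trans
      ((hwalks ⟨0, hn⟩).trans (ht _)).symm)
  · simp only [Bool.and_eq_true, Nat.beq_eq] at hMe
    obtain ⟨⟨rfl, hlen⟩, hemb⟩ := hMe
    obtain ⟨q, -, hq, hqn, hql, hadj⟩ :=
      exists_list_of_embeds (List.nodup_singleton 0) (by simpa using hn) hemb
    have hqlen : q.length = n := by
      rw [hql, List.length_tail, List.length_singleton]
      omega
    refine ⟨M, hM, rfl, hlen,
      fun i => ⟨q[(i : ℕ)], hqn _ (List.getElem_mem _)⟩, fun i j hij => ?_, ?_⟩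
    · have := (hq.getElem_inj_iff).mp (Fin.mk.inj_iff.mp hij)
      exact Fin.ext this
    · intro i j hij nbrs hi hj
      obtain ⟨m, hm⟩ : ∃ m, (i : ℕ) = m + 1 := ⟨i - 1, by have : (j : ℕ) < i := hij; omega⟩
      obtain ⟨x, y, hx, hy, hxy⟩ := hadj m nbrs (by rw [List.getElem?_tail, ← hm, hi]) j hj
      rw [List.length_singleton, add_comm, ← hm] at hx
      obtain ⟨hx1, rfl⟩ := List.getElem?_eq_some_iff.mp hx
      obtain ⟨hy1, rfl⟩ := List.getElem?_eq_some_iff.mp hy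
      rw [rowAt_rowsBelow _ (hqn _ (List.getElem_mem _)), bit_eq_testBit, testBit_row] at hxy
      exact hxy.2.2

end RowSearch

/-! ### Orderings of the vertices, and isomorphisms of regular graphs -/

/-- The elements of a finite type can be ordered such that a given function is nondecreasing. -/
theorem exists_equiv_lt_iff_lt_card {V : Type u} [Fintype V] (c : V → ℕ) :
    ∃ e : Fin (Fintype.card V) ≃ V, ∀ m i,
      c (e i) < m ↔ (i : ℕ) < (Finset.univ.filter fun v => c v < m).card := by
  classical
  let e₀ := (Fintype.equivFin V).symm
  let e := (Tuple.sort (c ∘ e₀)).trans e₀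
  have hmono : Monotone (c ∘ e) := Tuple.monotone_sort (c ∘ e₀)
  refine ⟨e, fun m i => ?_⟩
  have hcard : (Finset.univ.filter fun v => c v < m).card
      = (Finset.univ.filter fun j => c (e j) < m).card :=
    Finset.card_bij' (fun v _ => e.symm v) (fun j _ => e j) (by simp) (by simp) (by simp)
      (by simp)
  rw [hcard]
  constructor
  · intro hi
    rw [← Nat.succ_le_iff, Nat.succ_eq_add_one, ← Fin.card_Iic]
    refine Finset.card_le_card fun j hj => ?_
    simpa using (hmono (Finset.mem_Iic.mp hj)).trans_lt hi
  · intro hi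
    by_contra hlt
    refine hi.not_ge ?_
    rw [← Fin.card_Iio i]
    refine Finset.card_le_card fun j hj => ?_
    rw [Finset.mem_Iio]
    by_contra hij
    exact hlt ((hmono (not_lt.mp hij)).trans_lt (by simpa using hj))

namespace SimpleGraph

theorem IsTriangleRegular.comap {V W : Type*} [Fintype V] [Fintype W] {G : SimpleGraph V} {k : ℕ}
    (hG : G.IsTriangleRegular k) (e : W ≃ V) : (G.comap e).IsTriangleRegular k := by
  classical
  obtain ⟨h1, t, h2⟩ := hG
  refine ⟨fun a => ?_, t, fun a => ?_⟩
  · rw [← h1 (e a), ← e.sum_comp]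
    rfl
  · rw [← h2 (e a), ← e.sum_comp]
    refine Finset.sum_congr rfl fun b _ => ?_
    rw [← e.sum_comp]
    rfl

open Classical in
/-- An injective graph morphism between graphs with the same number of vertices is an isomorphism
if the graphs are regular of the same degree. -/
theorem nonempty_iso_of_injective {V W : Type*} [Fintype V] [Fintype W] {G : SimpleGraph V}
    {H : SimpleGraph W} {k : ℕ} (hG : ∀ a, ∑ b, (if G.Adj a b then 1 else 0) = k)
    (hH : ∀ a, ∑ b, (if H.Adj a b then 1 else 0) = k)
    (hcard : Fintype.card W = Fintype.card V) {f : W → V} (hf : f.Injective)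
    (hadj : ∀ a b, H.Adj a b → G.Adj (f a) (f b)) : Nonempty (H ≃g G) := by
  have hbij := (Fintype.bijective_iff_injective_and_card f).mpr ⟨hf, hcard⟩
  refine ⟨⟨Equiv.ofBijective f hbij, fun {a b} => ⟨fun hab => ?_, hadj a b⟩⟩⟩
  -- The neighbours of `a` are mapped onto those of `f a`, as there are `k` of both.
  have hsub : (Finset.univ.filter fun b => H.Adj a b).image f
      ⊆ Finset.univ.filter fun b => G.Adj (f a) b := by
    intro x hx
    obtain ⟨b, hb, rfl⟩ := Finset.mem_image.mp hx
    simpa using hadj a b (by simpa using hb)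
  have heq := Finset.eq_of_subset_of_card_le hsub (by
    rw [Finset.card_image_of_injective _ hf, Finset.card_filter, Finset.card_filter, hG, hH])
  have hmem : f b ∈ Finset.univ.filter fun b => G.Adj (f a) b := by simpa using hab
  rw [← heq, Finset.mem_image] at hmem
  obtain ⟨c, hc, hcb⟩ := hmem
  rw [← hf hcb]
  simpa using hc

/-- The vertices of a regular graph of degree `k` can be ordered such that the neighbours of the
first vertex come right after it, followed by the remaining neighbours of the second vertex, which
is a neighbour of the first one if `k` is positive. -/
theorem exists_ordering {V : Type u} [Fintype V] {G : SimpleGraph V} {k : ℕ}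
    (hG : G.IsTriangleRegular k) (v₀ : V) :
    ∃ (n : ℕ) (hn : 0 < n) (e : Fin n ≃ V), n = Fintype.card V ∧
      (∀ j : Fin n, (G.comap e).Adj ⟨0, hn⟩ j ↔ 1 ≤ (j : ℕ) ∧ (j : ℕ) < k + 1) ∧
      ∃ s, k + 1 + s ≤ n ∧ ∀ h : 1 < n, ∀ j : Fin n,
        k + 1 ≤ (j : ℕ) → ((G.comap e).Adj ⟨1, h⟩ j ↔ (j : ℕ) < k + 1 + s) := by
  classical
  have hn : 0 < Fintype.card V := Fintype.card_pos_iff.mpr ⟨v₀⟩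
  have hdeg : ∀ a, (Finset.univ.filter fun b => G.Adj a b).card = k := fun a => by
    rw [Finset.card_filter]
    exact hG.1 a
  rcases Nat.eq_zero_or_pos k with rfl | hk
  · have hbot : ∀ a b, ¬ G.Adj a b := fun a b hab => by
      have := Finset.card_eq_zero.mp (hdeg a)
      simpa [hab] using Finset.ext_iff.mp this b
    refine ⟨_, hn, (Fintype.equivFin V).symm, rfl, fun j => ?_, 0, by omega, fun h j hj => ?_⟩
    · simp [hbot]
      omega
    · simp [hbot]
      omega
  · obtain ⟨v₁, hv₁⟩ := Finset.card_pos.mp ((hdeg v₀).symm ▸ hk)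
    replace hv₁ : G.Adj v₀ v₁ := by simpa using hv₁
    have hne : v₁ ≠ v₀ := hv₁.ne'
    -- The vertices are ordered by their value under this function.
    let c : V → ℕ := fun v => if v = v₀ then 0 else if v = v₁ then 1 else if G.Adj v₀ v then 2
      else if G.Adj v₁ v then 3 else 4
    obtain ⟨e, he⟩ := exists_equiv_lt_iff_lt_card c
    have h1 : (Finset.univ.filter fun v => c v < 1) = {v₀} := by
      ext v
      simp only [c, Finset.mem_filter, Finset.mem_univ, true_and, Finset.mem_singleton]
      split_ifs <;> simp_all
    have h2 : (Finset.univ.filter fun v => c v < 2) = {v₀, v₁} := by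
      ext v
      simp only [c, Finset.mem_filter, Finset.mem_univ, true_and, Finset.mem_singleton,
        Finset.mem_insert]
      split_ifs <;> simp_all
    have h3 : (Finset.univ.filter fun v => c v < 3)
        = insert v₀ (Finset.univ.filter fun v => G.Adj v₀ v) := by
      ext v
      simp only [c, Finset.mem_filter, Finset.mem_univ, true_and, Finset.mem_insert]
      split_ifs <;> simp_all
    have c1 : (Finset.univ.filter fun v => c v < 1).card = 1 := by rw [h1, Finset.card_singleton]
    have c2 : (Finset.univ.filter fun v => c v < 2).card = 2 := by
      rw [h2, Finset.card_pair hne.symm]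
    have c3 : (Finset.univ.filter fun v => c v < 3).card = k + 1 := by
      rw [h3, Finset.card_insert_of_notMem (by simp), hdeg]
    have c34 : (Finset.univ.filter fun v => c v < 3).card
        ≤ (Finset.univ.filter fun v => c v < 4).card :=
      Finset.card_le_card fun v hv => by
        simp only [Finset.mem_filter, Finset.mem_univ, true_and] at hv ⊢
        omega
    have c4 : (Finset.univ.filter fun v => c v < 4).card ≤ Fintype.card V := Finset.card_le_univ _
    have e0 : e ⟨0, hn⟩ = v₀ := by
      have := (he 1 ⟨0, hn⟩).mpr (by rw [c1]; exact one_pos)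
      have hmem : e ⟨0, hn⟩ ∈ Finset.univ.filter fun v => c v < 1 := by simpa using this
      rwa [h1, Finset.mem_singleton] at hmem
    have e1 : ∀ h : 1 < Fintype.card V, e ⟨1, h⟩ = v₁ := fun h => by
      have hmem : e ⟨1, h⟩ ∈ Finset.univ.filter fun v => c v < 2 := by
        simpa using (he 2 ⟨1, h⟩).mpr (by rw [c2]; exact one_lt_two)
      rw [h2, Finset.mem_insert, Finset.mem_singleton] at hmem
      refine hmem.resolve_left fun h' => ?_
      simpa using e.injective (h'.trans e0.symm)
    refine ⟨_, hn, e, rfl, fun j => ?_, (Finset.univ.filter fun v => c v < 4).card - (k + 1),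
      by omega, fun h j hj => ?_⟩
    · have hj1 := he 1 j
      have hj3 := he 3 j
      have hj : e j ∈ (Finset.univ.filter fun v => c v < 3) ↔ e j = v₀ ∨ G.Adj v₀ (e j) := by
        rw [h3]; simp
      have hj' : e j ∈ (Finset.univ.filter fun v => c v < 1) ↔ e j = v₀ := by rw [h1]; simp
      rw [Finset.mem_filter_univ] at hj hj'
      rw [c1] at hj1
      rw [c3] at hj3
      rw [comap_adj, e0]
      have : G.Adj v₀ (e j) → e j ≠ v₀ := fun h => h.ne'
      by_cases h5 : e j = v₀
      · have : ¬ G.Adj v₀ (e j) := fun h => h.ne' h5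
        have := hj1.mp (hj'.mpr h5)
        constructor
        · tauto
        · omega
      · have h6 : ¬ (j : ℕ) < 1 := fun h => h5 (hj'.mp (hj1.mpr h))
        rw [← hj3, hj]
        have : 1 ≤ (j : ℕ) := by omega
        tauto
    · have hj3 := he 3 j
      have hj4 := he 4 j
      rw [c3] at hj3
      have h5 : 3 ≤ c (e j) := by
        by_contra h
        have := hj3.mp (by omega)
        omega
      rw [comap_adj, e1 h, show k + 1 + ((Finset.univ.filter fun v => c v < 4).card - (k + 1))
        = (Finset.univ.filter fun v => c v < 4).card by omega, ← hj4]
      simp only [c] at h5 ⊢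
      split_ifs at h5 ⊢ with h6 h7 h8 h9 <;> simp_all

end SimpleGraph

/-! ### The graphs in the table -/

namespace SimpleGraph

section Homogeneous

theorem isHomogeneous_bot {V : Type*} : (⊥ : SimpleGraph V).IsHomogeneous := by
  classical
  exact fun i j => ⟨⟨Equiv.swap i j, by simp⟩, Equiv.swap_apply_left i j⟩

theorem isHomogeneous_top {V : Type*} : (⊤ : SimpleGraph V).IsHomogeneous := by
  classical
  exact fun i j => ⟨⟨Equiv.swap i j, by simp⟩, Equiv.swap_apply_left i j⟩

theorem IsHomogeneous.compl {V : Type*} {G : SimpleGraph V} (hG : G.IsHomogeneous) :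
    Gᶜ.IsHomogeneous := fun i j => by
  obtain ⟨σ, hσ⟩ := hG i j
  refine ⟨⟨σ.toEquiv, fun {a b} => ?_⟩, hσ⟩
  have h : G.Adj (σ.toEquiv a) (σ.toEquiv b) ↔ G.Adj a b := σ.map_rel_iff
  rw [compl_adj, compl_adj, h, σ.toEquiv.injective.ne_iff]

theorem IsHomogeneous.copies {V : Type*} {G : SimpleGraph V} (hG : G.IsHomogeneous) (m : ℕ) :
    (copies m G).IsHomogeneous := fun i j => by
  obtain ⟨σ, hσ⟩ := hG i.2 j.2
  refine ⟨⟨(Equiv.swap i.1 j.1).prodCongr σ.toEquiv, fun {a b} => ?_⟩,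
    Prod.ext (Equiv.swap_apply_left i.1 j.1) hσ⟩
  have h : G.Adj (σ.toEquiv a.2) (σ.toEquiv b.2) ↔ G.Adj a.2 b.2 := σ.map_rel_iff
  exact and_congr (Equiv.swap i.1 j.1).injective.eq_iff h

theorem isHomogeneous_circulantGraph {A : Type*} [AddGroup A] (s : Set A) :
    (circulantGraph s).IsHomogeneous := fun i j =>
  ⟨⟨Equiv.addRight (-i + j), fun {_ _} => circulantGraph_adj_translate⟩, by
    change i + (-i + j) = j
    simp⟩

theorem isHomogeneous_cycleGraph (n : ℕ) : (cycleGraph n).IsHomogeneous := by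
  cases n with
  | zero => exact fun i => i.elim0
  | succ n =>
    rw [cycleGraph_eq_circulantGraph]
    exact isHomogeneous_circulantGraph _

theorem isHomogeneous_cube : cube.IsHomogeneous := fun i j => by
  -- The translation by `i + j` in the group `(ℤ/2)³`.
  have hinv : Function.Involutive fun (x : Fin 3 → Bool) k => xor (x k) (xor (i k) (j k)) :=
    fun x => funext fun k => by simp
  refine ⟨⟨hinv.toPerm, fun {a b} => ?_⟩, funext fun k => ?_⟩
  · change (∃! k, xor (a k) (xor (i k) (j k)) ≠ xor (b k) (xor (i k) (j k))) ↔ ∃! k, a k ≠ b k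
    simp
  · change xor (i k) (xor (i k) (j k)) = j k
    simp

theorem IsHomogeneous.of_iso {V W : Type*} {G : SimpleGraph V} {H : SimpleGraph W}
    (hH : H.IsHomogeneous) (e : G ≃g H) : G.IsHomogeneous := fun i j => by
  obtain ⟨σ, hσ⟩ := hH (e i) (e j)
  exact ⟨(e.trans σ).trans e.symm, by
    change e.symm (σ (e i)) = j
    rw [hσ, RelIso.symm_apply_apply]⟩

theorem isHomogeneous_of_mem_table : ∀ T ∈ table, T.2.IsHomogeneous := by
  simp only [table, List.forall_mem_cons, List.not_mem_nil, false_imp_iff, implies_true, and_true]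
  and_intros
  all_goals first
    | exact isHomogeneous_bot
    | exact isHomogeneous_top
    | exact isHomogeneous_top.copies _
    | exact (isHomogeneous_top.copies _).compl
    | exact isHomogeneous_cycleGraph _
    | exact (isHomogeneous_cycleGraph _).compl
    | exact (isHomogeneous_cycleGraph _).copies _
    | exact ((isHomogeneous_cycleGraph _).copies _).compl
    | exact isHomogeneous_circulantGraph _
    | exact (isHomogeneous_circulantGraph _).compl
    | exact isHomogeneous_cube
    | exact isHomogeneous_cube.compl

end Homogeneous

theorem exists_equiv_fin_of_mem_table :
    ∀ T ∈ table, ∃ n : ℕ, 1 ≤ n ∧ n ≤ 8 ∧ Nonempty (Fin n ≃ T.1) := by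
  have key : ∀ (V : Type) [Fintype V], 1 ≤ Fintype.card V → Fintype.card V ≤ 8 →
      ∃ n : ℕ, 1 ≤ n ∧ n ≤ 8 ∧ Nonempty (Fin n ≃ V) :=
    fun V _ h1 h2 => ⟨_, h1, h2, ⟨(Fintype.equivFin V).symm⟩⟩
  simp only [table, List.forall_mem_cons, List.not_mem_nil, false_imp_iff, implies_true, and_true]
  and_intros
  all_goals exact key _ (by decide) (by decide)

instance {m : ℕ} {V : Type*} (G : SimpleGraph V) [DecidableRel G.Adj] :
    DecidableRel (copies m G).Adj :=
  fun _ _ => inferInstanceAs (Decidable (_ ∧ _))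

instance : DecidableRel wheel8.Adj :=
  inferInstanceAs (DecidableRel (circulantGraph ({1, 4, 7} : Set (ZMod 8))).Adj)

instance : DecidableRel cube.Adj :=
  fun x y => inferInstanceAs (Decidable (∃ i, x i ≠ y i ∧ ∀ j, x j ≠ y j → j = i))

section Invariant

/-- The numbers of vertices, of closed walks of length `3`, of pairs of vertices with a common
neighbour, and of pairs with a common neighbour in the complement. -/
noncomputable def walkInvariant (T : Σ V : Type, SimpleGraph V) : ℕ × ℕ × ℕ × ℕ :=
  (Nat.card T.1,
    Nat.card {p : T.1 × T.1 × T.1 //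
      T.2.Adj p.1 p.2.1 ∧ T.2.Adj p.2.1 p.2.2 ∧ T.2.Adj p.2.2 p.1},
    Nat.card {p : T.1 × T.1 // ∃ b, T.2.Adj p.1 b ∧ T.2.Adj b p.2},
    Nat.card {p : T.1 × T.1 // ∃ b, T.2ᶜ.Adj p.1 b ∧ T.2ᶜ.Adj b p.2})

theorem walkInvariant_eq_of_iso {S T : Σ V : Type, SimpleGraph V} (e : S.2 ≃g T.2) :
    walkInvariant S = walkInvariant T := by
  have h : ∀ a b, T.2.Adj (e.toEquiv a) (e.toEquiv b) ↔ S.2.Adj a b := fun a b => e.map_rel_iff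
  have hc : ∀ a b, T.2ᶜ.Adj (e.toEquiv a) (e.toEquiv b) ↔ S.2ᶜ.Adj a b := fun a b => by
    rw [compl_adj, compl_adj, h, e.toEquiv.injective.ne_iff]
  refine Prod.ext (Nat.card_congr e.toEquiv) (Prod.ext ?_ (Prod.ext ?_ ?_))
  · refine Nat.card_congr ((e.toEquiv.prodCongr (e.toEquiv.prodCongr e.toEquiv)).subtypeEquiv
      fun p => ?_)
    exact and_congr (h _ _).symm (and_congr (h _ _).symm (h _ _).symm)
  · refine Nat.card_congr ((e.toEquiv.prodCongr e.toEquiv).subtypeEquiv fun p => ?_)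
    exact e.toEquiv.exists_congr fun b => and_congr (h _ _).symm (h _ _).symm
  · refine Nat.card_congr ((e.toEquiv.prodCongr e.toEquiv).subtypeEquiv fun p => ?_)
    exact e.toEquiv.exists_congr fun b => and_congr (hc _ _).symm (hc _ _).symm

theorem nodup_map_walkInvariant_table : (table.map walkInvariant).Nodup := by
  simp only [table, List.map_cons, List.map_nil, walkInvariant, Nat.card_eq_fintype_card]
  decide +kernel

theorem pairwise_table : table.Pairwise fun S T => IsEmpty (S.2 ≃g T.2) :=
  (List.pairwise_map.mp nodup_map_walkInvariant_table).imp fun h =>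
    ⟨fun e => h (walkInvariant_eq_of_iso e)⟩

end Invariant

section Models

open Classical in
/-- The graph `T` is coded by the model `M`: it is regular of the given degree and, for a suitable
numbering of its vertices, the neighbours of each vertex that come before it are listed in the
code. -/
def IsCodedBy (T : Σ V : Type, SimpleGraph V) (M : ℕ × List (List ℕ)) : Prop :=
  ∃ e : Fin M.2.length ≃ T.1,
    (∀ i, ∑ j, (if T.2.Adj (e i) (e j) then 1 else 0) = M.1) ∧
    ∀ i j : Fin M.2.length, j < i → T.2.Adj (e i) (e j) → (j : ℕ) ∈ M.2[i]

theorem isCodedBy_of_equiv {V : Type} {G : SimpleGraph V} [DecidableRel G.Adj]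
    {M : ℕ × List (List ℕ)} (e : Fin M.2.length ≃ V)
    (h : (∀ i, ∑ j, (if G.Adj (e i) (e j) then 1 else 0) = M.1) ∧
      ∀ i j : Fin M.2.length, j < i → G.Adj (e i) (e j) → (j : ℕ) ∈ M.2[i]) :
    IsCodedBy ⟨V, G⟩ M := by
  refine ⟨e, fun i => ?_, h.2⟩
  rw [← h.1 i]
  exact Finset.sum_congr rfl fun j _ => by congr

/-- The pentagon is isomorphic to its complement, by doubling. -/
theorem nonempty_iso_compl_cycleGraph_five : Nonempty ((cycleGraph 5)ᶜ ≃g cycleGraph 5) :=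
  ⟨⟨Equiv.ofBijective (fun x : Fin 5 => 2 * x) (by decide), fun {a b} => by
    revert a b
    decide⟩⟩

/-- The model `M` codes a graph in the table whose complement is, up to isomorphism, in the
table. -/
def IsTableModel (M : ℕ × List (List ℕ)) : Prop :=
  ∃ T ∈ table, IsCodedBy T M ∧ ∃ T' ∈ table, Nonempty (T.2ᶜ ≃g T'.2)

/-- The graph and its complement are given by their positions `i` and `j` in the table. -/
theorem isTableModel_of_getElem? {V : Type} {G H : SimpleGraph V} [DecidableRel G.Adj]
    {M : ℕ × List (List ℕ)} (i j : ℕ) (hi : table[i]? = some ⟨V, G⟩)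
    (hj : table[j]? = some ⟨V, H⟩) (hc : Nonempty (Gᶜ ≃g H)) (e : Fin M.2.length ≃ V)
    (h : (∀ i, ∑ j, (if G.Adj (e i) (e j) then 1 else 0) = M.1) ∧
      ∀ i j : Fin M.2.length, j < i → G.Adj (e i) (e j) → (j : ℕ) ∈ M.2[i]) :
    IsTableModel M :=
  ⟨_, List.mem_of_getElem? hi, isCodedBy_of_equiv e h, _, List.mem_of_getElem? hj, hc⟩

theorem nonempty_iso_compl_bot (V : Type) :
    Nonempty ((⊥ : SimpleGraph V)ᶜ ≃g (⊤ : SimpleGraph V)) := by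
  rw [compl_bot]
  exact ⟨Iso.refl⟩

/-- The models in the order of the list: the edgeless graphs, copies of the segment, the pentagon,
the hexagon, two triangles, the heptagon, the octagon, two squares, two tetrahedra, the wheel and
the cube. -/
theorem isTableModel_of_mem_models : ∀ M ∈ RowSearch.models, IsTableModel M := by
  simp only [RowSearch.models, List.forall_mem_cons, List.not_mem_nil, false_imp_iff,
    implies_true, and_true]
  have hrefl : ∀ {V : Type} (G : SimpleGraph V), Nonempty (G ≃g G) := fun _ => ⟨Iso.refl⟩
  refine ⟨
    isTableModel_of_getElem? 0 0 rfl rfl (by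
      rw [Subsingleton.elim (⊥ : SimpleGraph (Fin 1))ᶜ ⊥]; exact hrefl _) (Equiv.refl _)
      (by decide),
    isTableModel_of_getElem? 1 2 rfl rfl (nonempty_iso_compl_bot _) (Equiv.refl _) (by decide),
    isTableModel_of_getElem? 3 4 rfl rfl (nonempty_iso_compl_bot _) (Equiv.refl _) (by decide),
    isTableModel_of_getElem? 5 10 rfl rfl (nonempty_iso_compl_bot _) (Equiv.refl _) (by decide),
    isTableModel_of_getElem? 6 11 rfl rfl (nonempty_iso_compl_bot _) (Equiv.refl _) (by decide),
    isTableModel_of_getElem? 7 12 rfl rfl (nonempty_iso_compl_bot _) (Equiv.refl _) (by decide),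
    isTableModel_of_getElem? 8 13 rfl rfl (nonempty_iso_compl_bot _) (Equiv.refl _) (by decide),
    isTableModel_of_getElem? 9 14 rfl rfl (nonempty_iso_compl_bot _) (Equiv.refl _) (by decide),
    isTableModel_of_getElem? 15 16 rfl rfl (hrefl _)
      (finProdFinEquiv (m := 2) (n := 2)).symm (by decide +kernel),
    isTableModel_of_getElem? 17 18 rfl rfl (hrefl _)
      (finProdFinEquiv (m := 3) (n := 2)).symm (by decide +kernel),
    isTableModel_of_getElem? 19 20 rfl rfl (hrefl _)
      (finProdFinEquiv (m := 4) (n := 2)).symm (by decide +kernel),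
    isTableModel_of_getElem? 27 27 rfl rfl nonempty_iso_compl_cycleGraph_five (Equiv.refl _)
      (by decide +kernel),
    isTableModel_of_getElem? 30 31 rfl rfl (hrefl _) (Equiv.refl _) (by decide +kernel),
    isTableModel_of_getElem? 21 22 rfl rfl (hrefl _)
      (finProdFinEquiv (m := 2) (n := 3)).symm (by decide +kernel),
    isTableModel_of_getElem? 28 29 rfl rfl (hrefl _) (Equiv.refl _) (by decide +kernel),
    isTableModel_of_getElem? 32 33 rfl rfl (hrefl _) (Equiv.refl _) (by decide +kernel),
    isTableModel_of_getElem? 25 26 rfl rfl (hrefl _)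
      (finProdFinEquiv (m := 2) (n := 4)).symm (by decide +kernel),
    isTableModel_of_getElem? 23 24 rfl rfl (hrefl _)
      (finProdFinEquiv (m := 2) (n := 4)).symm (by decide +kernel),
    isTableModel_of_getElem? 34 35 rfl rfl (hrefl _) (Equiv.refl (Fin 8)) (by decide +kernel),
    isTableModel_of_getElem? 36 37 rfl rfl (hrefl _)
      (Equiv.ofBijective (fun i k => (i : ℕ).testBit k) (by decide +kernel)) (by decide +kernel)⟩

end Models

end SimpleGraph

/-! ### The classification -/

namespace SimpleGraph

/-- Graphs on at most `8` vertices that are regular of small degree with constant triangle counts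
are in the table, and so are their complements. -/
theorem IsTriangleRegular.exists_mem_table {V : Type u} [Fintype V] [Nonempty V]
    {G : SimpleGraph V} {k : ℕ} (hG : G.IsTriangleRegular k) (hV : Fintype.card V ≤ 8)
    (hk : 2 * k + 1 ≤ Fintype.card V) :
    (∃ T ∈ table, Nonempty (G ≃g T.2)) ∧ ∃ T ∈ table, Nonempty (Gᶜ ≃g T.2) := by
  classical
  obtain ⟨v₀⟩ := ‹Nonempty V›
  obtain ⟨n, hn, e, hcard, h0, h1⟩ := exists_ordering hG v₀
  have hGe := hG.comap e
  obtain ⟨M, hM, rfl, rfl, f, hf, hadj⟩ := RowSearch.exists_injective_of_ordered hn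
    (by omega) (by omega) hGe h0 h1
  obtain ⟨T, hT, ⟨e', hreg, hcode⟩, T', hT', ⟨φ⟩⟩ := isTableModel_of_mem_models M hM
  obtain ⟨ψ⟩ : Nonempty (T.2.comap e' ≃g G.comap e) := by
    refine nonempty_iso_of_injective hGe.1 hreg rfl hf fun a b hab => ?_
    have key : ∀ a b, b < a → T.2.Adj (e' a) (e' b) → (G.comap e).Adj (f a) (f b) :=
      fun a b hlt h => hadj a b hlt _ (List.getElem?_eq_getElem a.2) (hcode a b hlt h)
    rcases lt_trichotomy a b with hlt | rfl | hlt
    · exact (key b a hlt hab.symm).symm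
    · exact (hab.ne rfl).elim
    · exact key a b hlt hab
  have χ : G ≃g T.2 := ((Iso.comap e G).symm.trans ψ.symm).trans (Iso.comap e' T.2)
  have χc : Gᶜ ≃g T.2ᶜ := ⟨χ.toEquiv, fun {a b} => by
    have h : T.2.Adj (χ.toEquiv a) (χ.toEquiv b) ↔ G.Adj a b := χ.map_rel_iff
    rw [compl_adj, compl_adj, h, χ.toEquiv.injective.ne_iff]⟩
  exact ⟨⟨T, hT, ⟨χ⟩⟩, T', hT', ⟨χc.trans φ⟩⟩

/-- Regular graphs and their complements have complementary degrees. -/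
theorem IsTriangleRegular.add_compl {V : Type u} [Fintype V] [Nonempty V] {G : SimpleGraph V}
    {k l : ℕ} (hG : G.IsTriangleRegular k) (hGc : Gᶜ.IsTriangleRegular l) :
    k + l + 1 = Fintype.card V := by
  classical
  obtain ⟨v⟩ := ‹Nonempty V›
  have h : ∀ b, ((if G.Adj v b then 1 else 0) + (if Gᶜ.Adj v b then 1 else 0)) +
      (if v = b then 1 else 0) = 1 := fun b => by
    by_cases h1 : v = b
    · simp [h1]
    · by_cases h2 : G.Adj v b <;> simp [h1, h2]
  have hc : ∑ b, (if Gᶜ.Adj v b then 1 else 0) = l := by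
    rw [← hGc.1 v]
    exact Finset.sum_congr rfl fun b _ => by congr
  have hsum := Finset.sum_congr rfl fun b (_ : b ∈ Finset.univ) => h b
  rw [Finset.sum_add_distrib, Finset.sum_add_distrib, hG.1, hc] at hsum
  simpa using hsum

theorem IsQuantumHomogeneous.exists_mem_table {V : Type u} [Fintype V] [Nonempty V]
    {G : SimpleGraph V} (hG : G.IsQuantumHomogeneous) (hV : Fintype.card V ≤ 8) :
    ∃ T ∈ table, Nonempty (G ≃g T.2) := by
  obtain ⟨k, hk⟩ := hG.isTriangleRegular
  obtain ⟨l, hl⟩ := hG.isTriangleRegular_compl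
  have hkl := hk.add_compl hl
  by_cases h : 2 * k + 1 ≤ Fintype.card V
  · exact (hk.exists_mem_table hV h).1
  · have := (hl.exists_mem_table hV (by omega)).2
    rwa [compl_compl] at this

theorem isHomogeneous_of_iso_mem_table {V : Type u} {G : SimpleGraph V}
    (h : ∃ T ∈ table, Nonempty (G ≃g T.2)) : G.IsHomogeneous := by
  obtain ⟨T, hT, ⟨e⟩⟩ := h
  exact (isHomogeneous_of_mem_table T hT).of_iso e

theorem ncard_quantumHomogeneous_classes :
    {c : Quotient isoSetoid | ∃ (n : ℕ) (G : SimpleGraph (Fin n)),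
      1 ≤ n ∧ n ≤ 8 ∧ G.IsQuantumHomogeneous ∧ c = ⟦⟨n, G⟩⟧}.ncard = 38 := by
  have hex : ∀ i : Fin table.length, ∃ (n : ℕ) (G : SimpleGraph (Fin n)), 1 ≤ n ∧ n ≤ 8 ∧
      Nonempty (G ≃g table[i].2) := fun i => by
    obtain ⟨n, h1, h8, ⟨e⟩⟩ := exists_equiv_fin_of_mem_table _ (List.getElem_mem i.2)
    exact ⟨n, _, h1, h8, ⟨Iso.comap e _⟩⟩
  choose n G h1 h8 e using hex
  let cls : Fin table.length → Quotient isoSetoid := fun i => ⟦⟨n i, G i⟩⟧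
  have hinj : Function.Injective cls := by
    intro i j hij
    obtain ⟨φ⟩ : Nonempty (G i ≃g G j) := Quotient.exact hij
    have hpair := List.pairwise_iff_getElem.mp pairwise_table
    by_contra hne
    rcases lt_or_gt_of_ne hne with hlt | hlt
    · exact (hpair i j i.2 j.2 hlt).false (((e i).some.symm.trans φ).trans (e j).some)
    · exact (hpair j i j.2 i.2 hlt).false (((e j).some.symm.trans φ.symm).trans (e i).some)
  have hrange : {c : Quotient isoSetoid | ∃ (n : ℕ) (G : SimpleGraph (Fin n)),
      1 ≤ n ∧ n ≤ 8 ∧ G.IsQuantumHomogeneous ∧ c = ⟦⟨n, G⟩⟧} = Set.range cls := by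
    ext c
    constructor
    · rintro ⟨m, H, hm1, hm8, hH, rfl⟩
      have : Nonempty (Fin m) := ⟨⟨0, hm1⟩⟩
      obtain ⟨T, hT, ⟨φ⟩⟩ := hH.exists_mem_table (by simpa using hm8)
      obtain ⟨i, hi, rfl⟩ := List.getElem_of_mem hT
      exact ⟨⟨i, hi⟩, Quotient.sound ⟨(e ⟨i, hi⟩).some.trans φ.symm⟩⟩
    · rintro ⟨i, rfl⟩
      exact ⟨n i, G i, h1 i, h8 i, (isHomogeneous_of_iso_mem_table
        ⟨_, List.getElem_mem i.2, e i⟩).isQuantumHomogeneous, rfl⟩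
  rw [hrange, ← Set.image_univ, Set.ncard_image_of_injective _ hinj, Set.ncard_univ, Nat.card_fin]
  rfl

end SimpleGraph

theorem theorem8p1 :
    (∀ (V : Type*) [Fintype V] (G : SimpleGraph V), Fintype.card V ≤ 8 →
      (G.IsQuantumHomogeneous ↔ G.IsHomogeneous)) ∧
    {c : Quotient SimpleGraph.isoSetoid | ∃ (n : ℕ) (G : SimpleGraph (Fin n)),
      1 ≤ n ∧ n ≤ 8 ∧ G.IsQuantumHomogeneous ∧ c = ⟦⟨n, G⟩⟧}.ncard = 38 ∧
    (∀ (V : Type*) [Fintype V] (G : SimpleGraph V), 1 ≤ Fintype.card V → Fintype.card V ≤ 8 →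
      (G.IsQuantumHomogeneous ↔ ∃ T ∈ SimpleGraph.table, Nonempty (G ≃g T.2))) ∧
    SimpleGraph.table.Pairwise (fun S T => IsEmpty (S.2 ≃g T.2)) := by
  refine ⟨fun V _ G hV => ⟨fun hG => ?_, fun hG => hG.isQuantumHomogeneous⟩,
    SimpleGraph.ncard_quantumHomogeneous_classes, fun V _ G h1 h8 => ⟨fun hG => ?_, fun hG => ?_⟩,
    SimpleGraph.pairwise_table⟩
  · rcases isEmpty_or_nonempty V with hE | hN
    · exact fun i => hE.elim i
    · exact SimpleGraph.isHomogeneous_of_iso_mem_table (hG.exists_mem_table hV)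
  · have : Nonempty V := Fintype.card_pos_iff.mp h1
    exact hG.exists_mem_table h8
  · exact (SimpleGraph.isHomogeneous_of_iso_mem_table hG).isQuantumHomogeneous
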